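/- **Setting.** Let $U$ be a finite set with $n=|U|$. Let $M=(U,\mathcal I)$ be a matroid of rank $r\ge 2$, accessed through a membership oracle for $\mathcal I$. Let $f:2^U\to\mathbb R$ be normalized ($f(\emptyset)=0$), monotone and submodular, accessed through a value oracle. Let $c\in(0,1]$ be an upper bound on the curvature of $f$, that is, $f(A\cup\{x\})-f(A)\ge(1-c)f(\{x\})$ for all $A\subseteq U$ and $x\notin A$. Let $0<\varepsilon\le 1$ and $\alpha>0$. Write $H_k=\sum_{t=1}^k 1/t$, $S+x=S\cup\{x\}$ and $S-e=S\setminus\{e\}$. **Potential and its estimate.** For integers $0\le b\le a$ put $$m_{a,b}=\int_0^1\frac{ce^{cp}}{e^c-1}\,p^b(1-p)^{a-b}\,dp ,$$ and $m_{a,b}=0$ if $a<0$ or $b<0$. Define $$g(A)=\sum_{B\subseteq A}m_{|A|-1,|B|-1}f(B),\qquad \tau(A)=\sum_{B\subseteq A}m_{|A|-1,|B|-1}.$$ For $A\neq\emptyset$ let $\nu_A$ be the probability distribution on subsets of $A$ with $\nu_A(B)=m_{|A|-1,|B|-1}/\tau(A)$. Put $$\varepsilon_2=\frac{\varepsilon}{4rH_r},\qquad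 I=\left\lceil\left(\frac{1+\varepsilon_2}{1-\varepsilon_2}(2+3r\varepsilon_2)-1\right)\varepsilon_2^{-1}\right\rceil,$$ $$N=\left\lceil\frac12\left(\frac{ce^c}{e^c-1}\cdot\frac{H_n}{\varepsilon_2}\right)^2\ln\left((I+1)\,r\,n^{1+\alpha}\right)\right\rceil .$$ Each time an estimate $\tilde g(A)$ of $g(A)$ is computed, $N$ fresh independent samples $B_1,\dots,B_N\sim\nu_A$ are drawn and $\tilde g(A)=\tau(A)\frac1N\sum_{i=1}^N f(B_i)$. **Algorithm.** (1) Greedy phase: starting from $S=\emptyset$, for $r$ rounds, replace $S$ by $S+x$, where $x\in U\setminus S$ maximizes the computed $\tilde g(S+x)$ among all $x$ with $S+x\in\mathcal I$. Then compute $v=\tilde g(S)$. (2) Local search: for at most $I$ iterations, run through the pairs $(e,x)$ with $e\in S$, $x\in U\setminus S$; whenever $S'=S-e+x\in\mathcal I$, compute $v'=\tilde g(S')$, and if $v'>(1+\varepsilon_2)v$, set $S\leftarrow S'$, $v\leftarrow v'$ and go to the next iteration. If all pairs have been examined without such an improvement, return $S$. If $I$ iterations have been made without returning, return an error. The orders in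 which elements and pairs are examined are arbitrary; ties in the greedy phase are broken in favour of the element examined first. The running time is the number of steps, where a value query, a membership query, the drawing of one random set from some $\nu_A$, and an elementary operation (an arithmetic operation or comparison of reals, or an update of the state) each count as one step. The parameters $r,n,\varepsilon_2,I,N$ and the numbers $\tau(A)$, which depend only on $c$ and $|A|$, are taken as given. **Theorem.** There are absolute constants $C>0$ and $d\in\mathbb N$ such that for all $M,f,c,\varepsilon,\alpha$ as above, and all orders of examination: 1. the algorithm always stops within $$C\left(\log\frac n\varepsilon\right)^{d}\cdot r^4\,n\,\varepsilon^{-3}\max(1,\alpha)$$ steps, i.e. it runs in time $\tilde O(r^4n\varepsilon^{-3}\alpha)$ for $\alpha\ge1$; 2. with probability at least $1-C\,n^{-\alpha}$ it returns a $\left(\frac{1-e^{-c}}{c}-\varepsilon\right)$-approximate solution, i.e. a set $S\in\mathcal I$ with $$f(S)\ge\left(\frac{1-e^{-c}}{c}-\varepsilon\right)f(O)\quad\text{for every }O\in\mathcal I.$$ -/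

import Mathlib

/-! ### Monotone submodular functions and curvature -/

universe u v w

/-- `f` is normalized: `f ∅ = 0`. -/
def IsNormalized {U : Type u} (f : Finset U → ℝ) : Prop := f ∅ = 0

/-- Submodularity: if `A ⊆ B` and `C` is disjoint from `B`, the marginal of `C` with respect to `A`
is at least the marginal of `C` with respect to `B`. -/
def IsSubmodular {U : Type u} [DecidableEq U] (f : Finset U → ℝ) : Prop :=
  ∀ A B C : Finset U, A ⊆ B → Disjoint C B → f (B ∪ C) - f B ≤ f (A ∪ C) - f A

/-- `f` has curvature (at most) `c`: `f (A + x) - f A ≥ (1 - c) f {x}` for all `x ∉ A`. -/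
def HasCurvature {U : Type u} [DecidableEq U] (f : Finset U → ℝ) (c : ℝ) : Prop :=
  ∀ (A : Finset U) (x : U), x ∉ A → (1 - c) * f {x} ≤ f (insert x A) - f A

/-- The approximation ratio `(1 - e^{-c}) / c`. -/
noncomputable def rho (c : ℝ) : ℝ := (1 - Real.exp (-c)) / c

/-! ### The coefficients of the potential function and the sampling distribution -/

/-- The density `c e^{cp} / (e^c - 1)` on `[0, 1]`. -/
noncomputable def density (c p : ℝ) : ℝ := c * Real.exp (c * p) / (Real.exp c - 1)

/-- `m_{a,b} = ∫₀¹ (c e^{cp} / (e^c - 1)) p^b (1 - p)^{a - b} dp`, and `m_{a,b} = 0` if `a` or `b` is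
negative. It is only used for `b ≤ a`, where both exponents are nonnegative. -/
noncomputable def mcoeff (c : ℝ) (a b : ℤ) : ℝ :=
  if a < 0 ∨ b < 0 then 0
  else ∫ p in (0 : ℝ)..1, density c p * (p ^ b.toNat * (1 - p) ^ (a - b).toNat)

/-- `τ(A) = ∑_{B ⊆ A} m_{|A| - 1, |B| - 1}`. -/
noncomputable def tau {U : Type u} (c : ℝ) (A : Finset U) : ℝ :=
  ∑ B ∈ A.powerset, mcoeff c ((A.card : ℤ) - 1) ((B.card : ℤ) - 1)

/-- The potential function `g(A) = ∑_{B ⊆ A} m_{|A| - 1, |B| - 1} f(B)`, which is the quantity that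
the algorithm estimates. -/
noncomputable def potential {U : Type u} (c : ℝ) (f : Finset U → ℝ) (A : Finset U) : ℝ :=
  ∑ B ∈ A.powerset, mcoeff c ((A.card : ℤ) - 1) ((B.card : ℤ) - 1) * f B

theorem density_nonneg (c p : ℝ) : 0 ≤ density c p := by
  unfold density
  rcases le_total 0 c with h | h
  · have : 1 ≤ Real.exp c := Real.one_le_exp h
    exact div_nonneg (mul_nonneg h (Real.exp_pos _).le) (by linarith)
  · have : Real.exp c ≤ 1 := Real.exp_le_one_iff.mpr h
    exact div_nonneg_of_nonpos (mul_nonpos_of_nonpos_of_nonneg h (Real.exp_pos _).le)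
      (by linarith)

theorem mcoeff_nonneg (c : ℝ) (a b : ℤ) : 0 ≤ mcoeff c a b := by
  unfold mcoeff
  split_ifs
  · exact le_rfl
  · refine intervalIntegral.integral_nonneg zero_le_one fun p hp => ?_
    exact mul_nonneg (density_nonneg c p)
      (mul_nonneg (pow_nonneg hp.1 _) (pow_nonneg (by linarith [hp.2]) _))

/-- For `0 < c`, the normalizing constant `τ(A)` vanishes only at `A = ∅`. -/
theorem tau_pos {U : Type u} {c : ℝ} (hc : 0 < c) {A : Finset U} (hA : A.Nonempty) :
    0 < tau c A := by
  unfold tau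
  refine Finset.sum_pos' (fun _ _ => mcoeff_nonneg _ _ _) ⟨A, Finset.mem_powerset_self A, ?_⟩
  have h1 : 1 ≤ A.card := hA.card_pos
  unfold mcoeff
  rw [if_neg (by omega)]
  have hexp : 0 < Real.exp c - 1 := by linarith [Real.add_one_lt_exp hc.ne']
  refine intervalIntegral.intervalIntegral_pos_of_pos_on ?_ (fun p hp => ?_) zero_lt_one
  · apply Continuous.intervalIntegrable
    unfold density
    fun_prop
  · have hp0 : 0 < p := hp.1
    simp only [sub_self, Int.toNat_zero, pow_zero, mul_one]
    exact mul_pos (div_pos (mul_pos hc (Real.exp_pos _)) hexp) (pow_pos hp0 _)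

open scoped Classical in
/-- The distribution `ν_A(B) = m_{|A| - 1, |B| - 1} / τ(A)` on the subsets `B` of `A`.
(If `τ(A) = 0`, which for `0 < c` means `A = ∅`, it is the point mass at `∅`.) -/
noncomputable def nu {U : Type u} (c : ℝ) (A : Finset U) : PMF (Finset U) :=
  if h : 0 < tau c A then
    PMF.ofFinset
      (fun B => if B ⊆ A then
        ENNReal.ofReal (mcoeff c ((A.card : ℤ) - 1) ((B.card : ℤ) - 1) / tau c A) else 0)
      A.powerset
      (by
        rw [Finset.sum_congr rfl (fun B hB => if_pos (Finset.mem_powerset.mp hB)),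
          ← ENNReal.ofReal_sum_of_nonneg
            (fun B _ => div_nonneg (mcoeff_nonneg _ _ _) h.le),
          ← Finset.sum_div]
        have : (∑ B ∈ A.powerset, mcoeff c ((A.card : ℤ) - 1) ((B.card : ℤ) - 1)) / tau c A = 1 :=
          div_self h.ne'
        rw [this, ENNReal.ofReal_one])
      (fun B hB => if_neg (fun h' => hB (Finset.mem_powerset.mpr h')))
  else PMF.pure ∅

/-! ### Randomized oracle programs -/

/-- A randomized program on the ground set `U` returning a value in `α`. It reaches the instance
only through queries to the membership oracle and to the value oracle. -/
inductive Prog (U : Type u) (α : Type v) : Type (max u v)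
  /-- stop with output `a` -/
  | done (a : α) : Prog U α
  /-- one elementary operation (an arithmetic operation, a comparison, an update of the state) -/
  | step (k : Prog U α) : Prog U α
  /-- query the membership oracle at `B` -/
  | member (B : Finset U) (k : Bool → Prog U α) : Prog U α
  /-- query the value oracle at `B` -/
  | value (B : Finset U) (k : ℝ → Prog U α) : Prog U α
  /-- draw a fresh random set with law `μ` -/
  | sample (μ : PMF (Finset U)) (k : Finset U → Prog U α) : Prog U α

namespace Prog

/-- Sequential composition. -/
def bind {U : Type u} {α : Type v} {β : Type w} : Prog U α → (α → Prog U β) → Prog U β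
  | done a, q => q a
  | step k, q => step (k.bind q)
  | member B k, q => member B fun b => (k b).bind q
  | value B k, q => value B fun y => (k y).bind q
  | sample μ k, q => sample μ fun B => (k B).bind q

open scoped Classical in
/-- The joint law of the output and the running time of a program on the instance `(M, f)`. Every
elementary operation, membership query, value query and random draw takes one unit of time. -/
noncomputable def run {U : Type u} {α : Type v} (M : Matroid U) (f : Finset U → ℝ) :
    Prog U α → PMF (α × ℕ)
  | done a => PMF.pure (a, 0)
  | step k => (run M f k).map fun z => (z.1, z.2 + 1)
  | member B k => (run M f (k (decide (M.Indep (B : Set U))))).map fun z => (z.1, z.2 + 1)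
  | value B k => (run M f (k (f B))).map fun z => (z.1, z.2 + 1)
  | sample μ k => μ.bind fun B => (run M f (k B)).map fun z => (z.1, z.2 + 1)

end Prog

/-! ### The algorithm -/

/-- The order in which the loops of the algorithm run through the elements outside the current set
`S`, and through the pairs `(e, x)` with `e ∈ S` and `x ∉ S`. It is arbitrary and may depend
on `S`. -/
structure ScanOrder (U : Type u) where
  elems : Finset U → List U
  elems_nodup : ∀ S, (elems S).Nodup
  mem_elems : ∀ S x, x ∈ elems S ↔ x ∉ S
  pairs : Finset U → List (U × U)
  pairs_nodup : ∀ S, (pairs S).Nodup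
  mem_pairs : ∀ S p, p ∈ pairs S ↔ p.1 ∈ S ∧ p.2 ∉ S

/-- `ε₂ = ε / (4 r H_r)`. -/
noncomputable def epsTwo (r : ℕ) (ε : ℝ) : ℝ := ε / (4 * r * (harmonic r : ℝ))

/-- The number of iterations `I = (((1 + ε₂) / (1 - ε₂)) (2 + 3 r ε₂) - 1) / ε₂`, rounded up. -/
noncomputable def numIter (r : ℕ) (ε : ℝ) : ℕ :=
  ⌈((1 + epsTwo r ε) / (1 - epsTwo r ε) * (2 + 3 * r * epsTwo r ε) - 1) / epsTwo r ε⌉₊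

/-- The number of samples
`N = (1/2) ((c e^c / (e^c - 1)) (H_n / ε₂))² ln ((I + 1) r n^{1 + α})`, rounded up. -/
noncomputable def numSamples (n r : ℕ) (c ε α : ℝ) : ℕ :=
  ⌈1 / 2 * (c * Real.exp c / (Real.exp c - 1) * ((harmonic n : ℝ) / epsTwo r ε)) ^ 2 *
    Real.log (((numIter r ε : ℝ) + 1) * r * (n : ℝ) ^ (1 + α))⌉₊

namespace LocalSearch

variable {U : Type u} [DecidableEq U]

/-- Add up the values of `f` on `k` independent samples from `μ`, starting from `acc`. -/
noncomputable def sampleSum (μ : PMF (Finset U)) : ℕ → ℝ → Prog U ℝ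
  | 0, acc => .done acc
  | k + 1, acc => .sample μ fun B => .value B fun y => .step (sampleSum μ k (acc + y))

/-- The estimate `τ(A) (1/N) ∑_{i ≤ N} f(B_i)` of the potential at `A`, where `B_1, …, B_N` are fresh
independent samples from `ν_A`. -/
noncomputable def estimate (c : ℝ) (N : ℕ) (A : Finset U) : Prog U ℝ :=
  (sampleSum (nu c A) N 0).bind fun s => .step (.done (tau c A * (1 / (N : ℝ)) * s))

/-- Whether the value `y` beats the best candidate found so far. -/
noncomputable def beats (y : ℝ) : Option (U × ℝ) → Bool
  | none => true
  | some (_, y₀) => decide (y₀ < y)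

/-- Run through a list of elements `x` and find one that maximizes the estimated potential of
`S + x` among those for which `S + x` is independent. -/
noncomputable def bestExtension (c : ℝ) (N : ℕ) (S : Finset U) :
    List U → Option (U × ℝ) → Prog U (Option (U × ℝ))
  | [], best => .done best
  | x :: L, best =>
    .member (insert x S) fun b =>
      if b then
        (estimate c N (insert x S)).bind fun y =>
          .step (bestExtension c N S L (if beats y best then some (x, y) else best))
      else bestExtension c N S L best

/-- `k` rounds of the standard greedy algorithm on the estimated potential, from the current set `S`
on. It stops early when no element can be added. -/
noncomputable def greedy (ord : ScanOrder U) (c : ℝ) (N : ℕ) : ℕ → Finset U → Prog U (Finset U)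
  | 0, S => .done S
  | k + 1, S =>
    (bestExtension c N S (ord.elems S) none).bind fun best =>
      match best with
      | none => .done S
      | some (x, _) => .step (greedy ord c N k (insert x S))

/-- Run through a list of pairs `(e, x)` and find the first one for which `S' = S - e + x` is
independent with an estimate `v' > (1 + ε₂) v`. It returns `(S', v')` if there is one. -/
noncomputable def findSwap (c : ℝ) (N : ℕ) (ε₂ : ℝ) (S : Finset U) (v : ℝ) :
    List (U × U) → Prog U (Option (Finset U × ℝ))
  | [] => .done none
  | (e, x) :: L =>
    .step (.member (insert x (S.erase e)) fun b =>
      if b then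
        (estimate c N (insert x (S.erase e))).bind fun v' =>
          .step (if (1 + ε₂) * v < v' then .done (some (insert x (S.erase e), v'))
            else findSwap c N ε₂ S v L)
      else findSwap c N ε₂ S v L)

/-- At most `k` iterations of local search from the current set `S`, with `v` the last estimate of
the potential of `S`. It returns `S` when no swap is found, and `none` (an error) when the iterations
are exhausted. -/
noncomputable def localSearch (ord : ScanOrder U) (c : ℝ) (N : ℕ) (ε₂ : ℝ) :
    ℕ → Finset U → ℝ → Prog U (Option (Finset U))
  | 0, _, _ => .done none
  | k + 1, S, v =>
    (findSwap c N ε₂ S v (ord.pairs S)).bind fun res =>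
      match res with
      | none => .done (some S)
      | some (S', v') => .step (localSearch ord c N ε₂ k S' v')

end LocalSearch

/-- The randomized non-oblivious local search algorithm, for matroids of rank `r` on `U`, with
curvature bound `c`, convergence parameter `ε` and confidence parameter `α`. -/
noncomputable def nonObliviousLocalSearch {U : Type u} [Fintype U] [DecidableEq U]
    (ord : ScanOrder U) (r : ℕ) (c ε α : ℝ) : Prog U (Option (Finset U)) :=
  (LocalSearch.greedy ord c (numSamples (Fintype.card U) r c ε α) r ∅).bind fun S =>
    (LocalSearch.estimate c (numSamples (Fintype.card U) r c ε α) S).bind fun v =>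
      LocalSearch.localSearch ord c (numSamples (Fintype.card U) r c ε α) (epsTwo r ε)
        (numIter r ε) S v

/-- The output is a `ratio`-approximate solution of the instance `(M, f)`: it is an independent set
(not the error) whose value is at least `ratio` times the value of every independent set. -/
def IsApproxSolution {U : Type u} (M : Matroid U) (f : Finset U → ℝ) (ratio : ℝ)
    (out : Option (Finset U)) : Prop :=
  ∃ S : Finset U, out = some S ∧ M.Indep (S : Set U) ∧
    ∀ O : Finset U, M.Indep (O : Set U) → ratio * f O ≤ f S

/-! The weights `mcoeff c |A| |B|` are the law of a random subset B of A: draw p with density c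
e^{cp}/(e^c - 1), then keep each element of A independently with probability p. The marginal g(A +
x) - g(A) of the potential is the mean of f(B + x) - f(B) under this law (`potential_insert`), so g
inherits monotonicity and diminishing marginals from f.

Write κ = `density c 1` = c e^c/(e^c - 1). The density satisfies w' = c w, and integration by parts
in p turns the sum of the marginals g(A) - g(A - a) into κ f(A) - c E f(B)
(`sum_meanMarginal_self`). Let s be a Brualdi bijection from A to another base O. Submodularity and
curvature bound the sum over a of f(B - a + s(a)) - f(B - a) below by f(O) - c f(B), for each B
(`sub_le_sum_erase`). On averaging, the terms c E f(B) cancel and the swaps lose at most κ f(A) -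
f(O) of potential in total (`sum_potential_swap_le`). At an exact local optimum this loss is
nonnegative, so f(O) ≤ κ f(A), and 1/κ is the ratio (1 - e^{-c})/c.

With estimates of relative error ε₂, each swap from the returned set may still gain up to 4 ε₂ g(A).
Since g(A) ≤ κ H_r f(A), the r swaps together cost at most 4 r ε₂ κ H_r f(A) = ε κ f(A), which
explains the choice of ε₂. The greedy base is within 2 + 3 r ε₂ of the maximum of g over bases, and
every accepted swap multiplies the estimate by more than 1 + ε₂, so by Bernoulli's inequality I
iterations suffice.

A sample satisfies 0 ≤ f(B) ≤ f(A) ≤ g(A), so Hoeffding's inequality yields a relative error. One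
estimate fails with probability at most 2/((I + 1) r n^{1+α}), and at most (I + 1) r n + 1 estimates
are made. The examined sets depend on earlier samples, but each estimate uses fresh ones, so the
union bound can be taken along the program (`FailsLE.bind`). The time bound needs no probability: it
holds on every branch. -/

/-! ### The coefficients: Pascal recursion and integration by parts. -/

theorem continuous_density (c : ℝ) : Continuous (density c) := by
  unfold density
  fun_prop

theorem mcoeff_eq_integral (c : ℝ) {a b : ℤ} (ha : 0 ≤ a) (hb : 0 ≤ b) :
    mcoeff c a b = ∫ p in (0 : ℝ)..1, density c p * (p ^ b.toNat * (1 - p) ^ (a - b).toNat) := by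
  unfold mcoeff
  rw [if_neg (by omega)]

theorem intervalIntegrable_density_mul (c : ℝ) (k l : ℕ) :
    IntervalIntegrable (fun p => density c p * (p ^ k * (1 - p) ^ l)) MeasureTheory.volume 0 1 :=
  Continuous.intervalIntegrable
    ((continuous_density c).mul ((continuous_pow k).mul ((continuous_const.sub continuous_id).pow l)))
    _ _

/-- The coefficients satisfy the recursion of a reversed Pascal triangle. -/
theorem mcoeff_pascal (c : ℝ) {a b : ℤ} (hb : 0 ≤ b) (hba : b ≤ a) :
    mcoeff c a b = mcoeff c (a + 1) b + mcoeff c (a + 1) (b + 1) := by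
  rw [mcoeff_eq_integral c (by omega) hb, mcoeff_eq_integral c (by omega) hb,
    mcoeff_eq_integral c (by omega) (by omega), ← intervalIntegral.integral_add
      (intervalIntegrable_density_mul c _ _) (intervalIntegrable_density_mul c _ _)]
  have h1 : (a + 1 - b).toNat = (a - b).toNat + 1 := by omega
  have h2 : (a + 1 - (b + 1)).toNat = (a - b).toNat := by omega
  have h3 : (b + 1).toNat = b.toNat + 1 := by omega
  rw [h1, h2, h3]
  congr 1
  funext p
  ring

theorem exp_sub_one_pos {c : ℝ} (hc : 0 < c) : 0 < Real.exp c - 1 := by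
  linarith [Real.add_one_lt_exp hc.ne']

theorem hasDerivAt_density (c p : ℝ) : HasDerivAt (density c) (c * density c p) p := by
  have h : HasDerivAt (fun p : ℝ => Real.exp (c * p)) (Real.exp (c * p) * c) p := by
    simpa using ((hasDerivAt_id p).const_mul c).exp
  refine ((h.const_mul c).div_const (Real.exp c - 1)).congr_deriv ?_
  unfold density
  ring

theorem integral_density {c : ℝ} (hc : 0 < c) : ∫ p in (0 : ℝ)..1, density c p = 1 := by
  have h : ∀ p ∈ Set.uIcc (0 : ℝ) 1,
      HasDerivAt (fun p => density c p / c) (density c p) p := fun p _ => by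
    refine ((hasDerivAt_density c p).div_const c).congr_deriv ?_
    field_simp
  rw [intervalIntegral.integral_eq_sub_of_hasDerivAt h
    ((continuous_density c).intervalIntegrable _ _)]
  have := (exp_sub_one_pos hc).ne'
  unfold density
  field_simp
  simp

theorem mcoeff_zero_zero {c : ℝ} (hc : 0 < c) : mcoeff c 0 0 = 1 := by
  rw [mcoeff_eq_integral c le_rfl le_rfl]
  simpa using integral_density hc

/-- Integration by parts for the coefficients. -/
theorem mcoeff_by_parts (c : ℝ) {a b : ℕ} (ha : 1 ≤ a) (hba : b ≤ a) :
    b * mcoeff c ((a : ℤ) - 1) ((b : ℤ) - 1) - ((a : ℝ) - b) * mcoeff c ((a : ℤ) - 1) b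
      + c * mcoeff c a b =
    (if b = a then density c 1 else 0) - (if b = 0 then density c 0 else 0) := by
  obtain ⟨l, rfl⟩ := Nat.exists_eq_add_of_le hba
  have hd : ∀ p ∈ Set.uIcc (0 : ℝ) 1,
      HasDerivAt (fun p => density c p * (p ^ b * (1 - p) ^ l))
        (b * (density c p * (p ^ (b - 1) * (1 - p) ^ l)) -
          l * (density c p * (p ^ b * (1 - p) ^ (l - 1)))
          + c * (density c p * (p ^ b * (1 - p) ^ l))) p := fun p _ => by
    have h1 : HasDerivAt (fun p : ℝ => (1 - p) ^ l) (l * (1 - p) ^ (l - 1) * (-1)) p := by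
      exact ((hasDerivAt_id p).const_sub 1).pow l
    refine ((hasDerivAt_density c p).mul ((hasDerivAt_pow b p).mul h1)).congr_deriv ?_
    simp only [Pi.mul_apply]
    ring
  have hi := intervalIntegrable_density_mul c
  have h := intervalIntegral.integral_eq_sub_of_hasDerivAt hd
    ((((hi _ _).const_mul _).sub ((hi _ _).const_mul _)).add ((hi _ _).const_mul _))
  rw [intervalIntegral.integral_add (((hi _ _).const_mul _).sub ((hi _ _).const_mul _))
      ((hi _ _).const_mul _), intervalIntegral.integral_sub ((hi _ _).const_mul _)
      ((hi _ _).const_mul _), intervalIntegral.integral_const_mul,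
    intervalIntegral.integral_const_mul, intervalIntegral.integral_const_mul] at h
  -- For `b = 0` the factor `b` kills both sides, so the truncated exponent `b - 1` is harmless; `l
  -- = 0` plays the same role in `e2`.
  have e1 : (b : ℝ) * mcoeff c (((b + l : ℕ) : ℤ) - 1) ((b : ℤ) - 1) =
      b * ∫ p in (0 : ℝ)..1, density c p * (p ^ (b - 1) * (1 - p) ^ l) := by
    rcases Nat.eq_zero_or_pos b with rfl | hb
    · simp
    · rw [mcoeff_eq_integral c (by omega) (by omega),
        show ((b : ℤ) - 1).toNat = b - 1 by omega,
        show (((b + l : ℕ) : ℤ) - 1 - ((b : ℤ) - 1)).toNat = l by omega]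
  have e2 : (((b + l : ℕ) : ℝ) - b) * mcoeff c (((b + l : ℕ) : ℤ) - 1) b =
      l * ∫ p in (0 : ℝ)..1, density c p * (p ^ b * (1 - p) ^ (l - 1)) := by
    rcases Nat.eq_zero_or_pos l with rfl | hl
    · simp
    · rw [mcoeff_eq_integral c (by omega) (by omega),
        show ((b : ℤ)).toNat = b by omega,
        show (((b + l : ℕ) : ℤ) - 1 - (b : ℤ)).toNat = l - 1 by omega]
      push_cast
      ring
  have e3 : mcoeff c ((b + l : ℕ) : ℤ) b =
      ∫ p in (0 : ℝ)..1, density c p * (p ^ b * (1 - p) ^ l) := by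
    rw [mcoeff_eq_integral c (by omega) (by omega), show ((b : ℤ)).toNat = b by omega,
        show (((b + l : ℕ) : ℤ) - (b : ℤ)).toNat = l by omega]
  rw [e1, e2, e3, h]
  simp [zero_pow_eq]

theorem density_le_density_one {c p : ℝ} (hc : 0 < c) (hp : p ≤ 1) :
    density c p ≤ density c 1 := by
  unfold density
  have := exp_sub_one_pos hc
  gcongr

theorem mcoeff_natCast_zero_le {c : ℝ} (hc : 0 < c) (a : ℕ) :
    mcoeff c a 0 ≤ density c 1 / (a + 1) := by
  have h : ∀ p ∈ Set.Icc (0 : ℝ) 1, density c p * (p ^ 0 * (1 - p) ^ a) ≤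
      density c 1 * (p ^ 0 * (1 - p) ^ a) := fun p hp =>
    mul_le_mul_of_nonneg_right (density_le_density_one hc hp.2)
      (mul_nonneg (pow_nonneg hp.1 _) (pow_nonneg (by linarith [hp.2]) _))
  rw [mcoeff_eq_integral c (by omega) le_rfl]
  simp only [sub_zero, Int.toNat_natCast, Int.toNat_zero]
  refine (intervalIntegral.integral_mono_on zero_le_one (intervalIntegrable_density_mul c 0 a)
    (Continuous.intervalIntegrable (by fun_prop) _ _) h).trans (le_of_eq ?_)
  rw [intervalIntegral.integral_const_mul]
  simp only [pow_zero, one_mul]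
  rw [intervalIntegral.integral_comp_sub_left (fun p : ℝ => p ^ a) 1]
  simp [div_eq_mul_inv]

/-! ### The potential: marginals, bounds, and the total loss along a family of swaps. -/

section Potential

variable {U : Type u} [DecidableEq U] {f : Finset U → ℝ} {c : ℝ}

/-- Average over the random subset `B` of `A` of the marginal of `x` with respect to `B`. -/
noncomputable def meanMarginal (c : ℝ) (f : Finset U → ℝ) (A : Finset U) (x : U) : ℝ :=
  ∑ B ∈ A.powerset, mcoeff c A.card B.card * (f (insert x B) - f B)

/-- Pair each B ⊆ A with B + x. By `mcoeff_pascal` the weight of B in g(A) splits into its weight in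
g(A + x) and the weight of B in the mean marginal. Only B = ∅ escapes the recursion, and there f
vanishes. -/
theorem potential_insert (hf : IsNormalized f) {A : Finset U} {x : U} (hx : x ∉ A) :
    potential c f (insert x A) = potential c f A + meanMarginal c f A x := by
  unfold potential meanMarginal
  rw [Finset.sum_powerset_insert hx, ← Finset.sum_add_distrib, ← Finset.sum_add_distrib]
  refine Finset.sum_congr rfl fun B hB => ?_
  have hBA := Finset.mem_powerset.mp hB
  have hcard := Finset.card_le_card hBA
  rw [Finset.card_insert_of_notMem hx, Finset.card_insert_of_notMem fun h => hx (hBA h)]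
  push_cast
  rw [add_sub_cancel_right, add_sub_cancel_right]
  rcases B.eq_empty_or_nonempty with rfl | hne
  · have h0 : f ∅ = 0 := hf
    simp [h0]
  · have h1 : 1 ≤ B.card := hne.card_pos
    have := mcoeff_pascal c (a := (A.card : ℤ) - 1) (b := (B.card : ℤ) - 1) (by omega) (by omega)
    rw [sub_add_cancel, sub_add_cancel] at this
    rw [this]
    ring

omit [DecidableEq U] in
theorem potential_empty (hf : IsNormalized f) : potential c f ∅ = 0 := by
  have h0 : f ∅ = 0 := hf
  simp [potential, h0]

/-- Sums over the random subsets of `A` and of `A.erase a` agree for functions that ignore `a`. -/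
theorem sum_powerset_erase {A : Finset U} {a : U} (ha : a ∈ A) (F : Finset U → ℝ) :
    ∑ B ∈ A.powerset, mcoeff c A.card B.card * F (B.erase a) =
      ∑ B ∈ (A.erase a).powerset, mcoeff c (A.erase a).card B.card * F B := by
  conv_lhs => rw [← Finset.insert_erase ha]
  rw [Finset.sum_powerset_insert (Finset.notMem_erase a A), ← Finset.sum_add_distrib]
  refine Finset.sum_congr rfl fun B hB => ?_
  have hBA := Finset.mem_powerset.mp hB
  have haB : a ∉ B := fun h => Finset.notMem_erase a A (hBA h)
  have hcard := Finset.card_le_card hBA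
  rw [Finset.card_insert_of_notMem (Finset.notMem_erase a A), Finset.card_insert_of_notMem haB,
    Finset.erase_insert haB, Finset.erase_eq_of_notMem haB,
    mcoeff_pascal c (a := (A.erase a).card) (b := B.card) (by omega) (by omega)]
  push_cast
  ring

theorem sum_mcoeff (hc : 0 < c) (A : Finset U) :
    ∑ B ∈ A.powerset, mcoeff c A.card B.card = 1 := by
  induction A using Finset.induction_on with
  | empty => simpa using mcoeff_zero_zero hc
  | insert x A hx ih =>
    have := sum_powerset_erase (c := c) (Finset.mem_insert_self x A) fun _ => 1
    simpa [Finset.erase_insert hx, ih] using this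

theorem IsSubmodular.insert_sub_le (hf : IsSubmodular f) (hm : Monotone f) {A B : Finset U}
    (hAB : A ⊆ B) (x : U) : f (insert x B) - f B ≤ f (insert x A) - f A := by
  by_cases hx : x ∈ B
  · rw [Finset.insert_eq_of_mem hx, sub_self, sub_nonneg]
    exact hm (Finset.subset_insert _ _)
  · have := hf A B {x} hAB (by simpa using hx)
    rwa [Finset.union_comm, ← Finset.insert_eq, Finset.union_comm, ← Finset.insert_eq] at this

theorem meanMarginal_nonneg (hm : Monotone f) (A : Finset U) (x : U) :
    0 ≤ meanMarginal c f A x :=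
  Finset.sum_nonneg fun _ _ =>
    mul_nonneg (mcoeff_nonneg _ _ _) (sub_nonneg.mpr (hm (Finset.subset_insert _ _)))

/-- Deleting y from the random subset of A + y gives the random subset of A, and under this coupling
the marginal of x can only grow. -/
theorem meanMarginal_insert_le (hm : Monotone f) (hf : IsSubmodular f) (A : Finset U) (x y : U) :
    meanMarginal c f (insert y A) x ≤ meanMarginal c f A x := by
  by_cases hy : y ∈ A
  · rw [Finset.insert_eq_of_mem hy]
  have := sum_powerset_erase (c := c) (Finset.mem_insert_self y A)
    fun B => f (insert x B) - f B
  rw [Finset.erase_insert hy] at this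
  unfold meanMarginal
  rw [← this]
  exact Finset.sum_le_sum fun B _ => mul_le_mul_of_nonneg_left
    (hf.insert_sub_le hm (Finset.erase_subset _ _) x) (mcoeff_nonneg _ _ _)

theorem meanMarginal_anti (hm : Monotone f) (hf : IsSubmodular f) {A B : Finset U} (h : A ⊆ B)
    (x : U) : meanMarginal c f B x ≤ meanMarginal c f A x := by
  rw [← Finset.sdiff_union_of_subset h]
  induction B \ A using Finset.induction_on with
  | empty => simp
  | insert y D _ ih =>
    rw [Finset.insert_union]
    exact (meanMarginal_insert_le hm hf _ x y).trans ih

theorem potential_mono (h0 : IsNormalized f) (hm : Monotone f) : Monotone (potential c f) := by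
  intro A B h
  rw [← Finset.sdiff_union_of_subset h]
  induction B \ A using Finset.induction_on with
  | empty => simp
  | insert y D _ ih =>
    rw [Finset.insert_union]
    by_cases hy : y ∈ D ∪ A
    · rwa [Finset.insert_eq_of_mem hy]
    · rw [potential_insert h0 hy]
      linarith [meanMarginal_nonneg (c := c) hm (D ∪ A) y]

theorem potential_nonneg (h0 : IsNormalized f) (hm : Monotone f) (A : Finset U) :
    0 ≤ potential c f A :=
  (potential_empty (c := c) h0).symm.le.trans (potential_mono h0 hm (Finset.empty_subset A))

theorem potential_insert_sub_le (h0 : IsNormalized f) (hm : Monotone f) (hf : IsSubmodular f)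
    {A B : Finset U} (h : A ⊆ B) (x : U) :
    potential c f (insert x B) - potential c f B ≤ potential c f (insert x A) - potential c f A := by
  by_cases hx : x ∈ B
  · rw [Finset.insert_eq_of_mem hx, sub_self, sub_nonneg]
    exact potential_mono h0 hm (Finset.subset_insert _ _)
  · rw [potential_insert h0 hx, potential_insert h0 fun h' => hx (h h')]
    linarith [meanMarginal_anti (c := c) hm hf h x]

/-- The marginal of f at A is below its marginal at every B ⊆ A, hence below their average. This
bound is what turns additive sampling errors into relative ones. -/
theorem le_potential (hc : 0 < c) (h0 : IsNormalized f) (hm : Monotone f) (hf : IsSubmodular f)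
    (A : Finset U) : f A ≤ potential c f A := by
  induction A using Finset.induction_on with
  | empty =>
    rw [potential_empty h0]
    exact h0.le
  | insert x A hx ih =>
    rw [potential_insert h0 hx]
    have : f (insert x A) - f A ≤ meanMarginal c f A x := by
      unfold meanMarginal
      calc f (insert x A) - f A
          = ∑ B ∈ A.powerset, mcoeff c A.card B.card * (f (insert x A) - f A) := by
            rw [← Finset.sum_mul, sum_mcoeff hc, one_mul]
        _ ≤ _ := Finset.sum_le_sum fun B hB => mul_le_mul_of_nonneg_left
            (hf.insert_sub_le hm (Finset.mem_powerset.mp hB) x) (mcoeff_nonneg _ _ _)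
    linarith

omit [DecidableEq U] in
theorem potential_le_tau_mul (hm : Monotone f) (A : Finset U) :
    potential c f A ≤ tau c A * f A := by
  unfold potential tau
  rw [Finset.sum_mul]
  gcongr with B hB
  · exact mcoeff_nonneg _ _ _
  · exact hm (Finset.mem_powerset.mp hB)

/-- Reading τ as the potential of the indicator of nonempty sets makes the recursion
`potential_insert` available for it. -/
theorem tau_eq_potential (A : Finset U) :
    tau c A = potential c (fun B => if B = ∅ then 0 else 1) A := by
  unfold tau potential
  refine Finset.sum_congr rfl fun B _ => ?_
  rcases B.eq_empty_or_nonempty with rfl | h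
  · simp [mcoeff]
  · simp [h.ne_empty]

/-- For the indicator of nonempty sets only B = ∅ has a nonzero marginal, so adding an element
raises τ by m_{|A|,0} ≤ κ/(|A| + 1); these bounds add up to a harmonic number. -/
theorem tau_le (hc : 0 < c) (A : Finset U) : tau c A ≤ density c 1 * harmonic A.card := by
  induction A using Finset.induction_on with
  | empty => simp [tau, mcoeff]
  | insert x A hx ih =>
    rw [tau_eq_potential] at ih ⊢
    rw [potential_insert (by simp [IsNormalized]) hx, Finset.card_insert_of_notMem hx,
      harmonic_succ]
    have : meanMarginal c (fun B => if B = ∅ then (0 : ℝ) else 1) A x = mcoeff c A.card 0 := by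
      unfold meanMarginal
      rw [Finset.sum_eq_single_of_mem ∅ (Finset.empty_mem_powerset A)]
      · simp
      · intro B _ hB
        simp [hB]
    rw [this]
    push_cast
    have := mcoeff_natCast_zero_le hc A.card
    rw [div_eq_mul_inv] at this
    linarith

theorem harmonic_cast_mono {a b : ℕ} (h : a ≤ b) : (harmonic a : ℝ) ≤ harmonic b := by
  unfold harmonic
  exact_mod_cast Finset.sum_le_sum_of_subset_of_nonneg (Finset.range_mono h)
    fun i _ _ => by positivity

theorem density_one_pos (hc : 0 < c) : 0 < density c 1 :=
  div_pos (mul_pos hc (Real.exp_pos _)) (exp_sub_one_pos hc)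

/-- Collect the coefficient of each f(B): it is the left side of `mcoeff_by_parts`, hence zero
except for the boundary terms at B = A, which gives κ, and at B = ∅, where f vanishes. -/
theorem sum_meanMarginal_self (h0 : IsNormalized f) (A : Finset U) :
    ∑ a ∈ A, meanMarginal c f (A.erase a) a +
      c * ∑ B ∈ A.powerset, mcoeff c A.card B.card * f B = density c 1 * f A := by
  have h00 : f ∅ = 0 := h0
  rcases A.eq_empty_or_nonempty with rfl | hA
  · simp [h00]
  have hA1 : 1 ≤ A.card := hA.card_pos
  -- Rewritten over all subsets of A, the marginal counts f(B) positively if B contains a and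
  -- negatively otherwise. After exchanging sums, B occurs |B| times with the first weight and |A| -
  -- |B| times with the second.
  have key : ∀ a ∈ A, meanMarginal c f (A.erase a) a = ∑ B ∈ A.powerset,
      if a ∈ B then mcoeff c ((A.card : ℤ) - 1) ((B.card : ℤ) - 1) * f B
        else - (mcoeff c ((A.card : ℤ) - 1) B.card * f B) := by
    intro a ha
    conv_rhs => rw [← Finset.insert_erase ha]
    rw [Finset.sum_powerset_insert (Finset.notMem_erase a A), ← Finset.sum_add_distrib]
    refine Finset.sum_congr rfl fun B hB => ?_
    have haB : a ∉ B := fun h => Finset.notMem_erase a A (Finset.mem_powerset.mp hB h)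
    rw [if_neg haB, if_pos (Finset.mem_insert_self a B), Finset.insert_erase ha,
      Finset.card_insert_of_notMem haB, Finset.card_erase_of_mem ha]
    push_cast [hA1]
    rw [add_sub_cancel_right]
    ring
  rw [Finset.sum_congr rfl key, Finset.sum_comm, Finset.mul_sum, ← Finset.sum_add_distrib,
    Finset.sum_eq_single_of_mem A (Finset.mem_powerset_self A)]
  · have := mcoeff_by_parts c hA1 le_rfl
    rw [if_pos rfl, if_neg (by omega)] at this
    rw [Finset.sum_congr rfl fun a ha => if_pos ha, Finset.sum_const, nsmul_eq_mul]
    linear_combination f A * this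
  · intro B hB hne
    have hBA := Finset.mem_powerset.mp hB
    have hlt : B.card < A.card := Finset.card_lt_card (lt_of_le_of_ne hBA hne)
    rcases B.eq_empty_or_nonempty with rfl | hBne
    · simp [h00]
    have := mcoeff_by_parts c hA1 hlt.le
    rw [if_neg hlt.ne, if_neg hBne.card_pos.ne'] at this
    rw [Finset.sum_ite, Finset.sum_const, Finset.sum_const, Finset.filter_mem_eq_inter,
      Finset.inter_eq_right.mpr hBA, Finset.filter_notMem_eq_sdiff,
      Finset.card_sdiff_of_subset hBA, nsmul_eq_mul, nsmul_eq_mul, Nat.cast_sub hlt.le]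
    linear_combination f B * this

theorem IsSubmodular.union_sub_le_sum (hf : IsSubmodular f) (hm : Monotone f) (B O : Finset U) :
    f (B ∪ O) - f B ≤ ∑ x ∈ O, (f (insert x B) - f B) := by
  induction O using Finset.induction_on with
  | empty => simp
  | insert x O hx ih =>
    rw [Finset.sum_insert hx, Finset.union_insert]
    have := hf.insert_sub_le hm (Finset.subset_union_left (s₁ := B) (s₂ := O)) x
    linarith

theorem HasCurvature.le_union_sub (hcurv : HasCurvature f c) {O D : Finset U} (h : Disjoint D O) :
    (1 - c) * ∑ x ∈ D, f {x} ≤ f (O ∪ D) - f O := by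
  induction D using Finset.induction_on with
  | empty => simp
  | insert x D hx ih =>
    rw [Finset.sum_insert hx, Finset.union_insert]
    have h' := Finset.disjoint_insert_left.mp h
    have := hcurv (O ∪ D) x (by simp [h'.1, hx])
    linarith [ih h'.2]

theorem IsSubmodular.le_sum_singleton (hf : IsSubmodular f) (hm : Monotone f)
    (h0 : IsNormalized f) (B : Finset U) : f B ≤ ∑ x ∈ B, f {x} := by
  have h00 : f ∅ = 0 := h0
  simpa [h00] using hf.union_sub_le_sum hm ∅ B

/-- Let O = s(A). The marginals over B - a dominate those over B, which sum to at least f(B ∪ O) -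
f(B). Elements of B ∩ O have zero marginal over B but contribute (1 - c) f({x}) by curvature.
Curvature also gives f(B ∪ O) ≥ f(O) + (1 - c) Σ f({x}) over B \ O. Together the singletons of B are
worth at least (1 - c) f(B), leaving f(O) - c f(B). -/
theorem sub_le_sum_erase (hf : IsSubmodular f) (hm : Monotone f) (h0 : IsNormalized f)
    (hcurv : HasCurvature f c) (hc1 : c ≤ 1) {A B : Finset U} (hBA : B ⊆ A) (s : U → U)
    (hinj : Set.InjOn s A) (hs : ∀ a ∈ A, s a ∉ A ∨ s a = a) :
    f (A.image s) - c * f B ≤ ∑ a ∈ A, (f (insert (s a) (B.erase a)) - f (B.erase a)) := by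
  set O := A.image s with hO
  have hterm : ∀ a ∈ A, (f (insert (s a) B) - f B) + (if s a ∈ B then (1 - c) * f {s a} else 0) ≤
      f (insert (s a) (B.erase a)) - f (B.erase a) := by
    intro a ha
    split_ifs with h
    · rcases hs a ha with h' | h'
      -- A value s(a) in B lies in A, which forces s(a) = a; so the second summand only ever
      -- concerns fixed points of s.
      · exact absurd (hBA h) h'
      · rw [Finset.insert_eq_of_mem h, sub_self, zero_add, h']
        exact hcurv _ _ (Finset.notMem_erase a B)
    · rw [add_zero]
      exact hf.insert_sub_le hm (Finset.erase_subset _ _) _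
  refine le_trans ?_ (Finset.sum_le_sum hterm)
  rw [Finset.sum_add_distrib]
  have e1 : ∑ a ∈ A, (f (insert (s a) B) - f B) = ∑ x ∈ O, (f (insert x B) - f B) :=
    (Finset.sum_image (f := fun x => f (insert x B) - f B) hinj).symm
  have e2 : ∑ a ∈ A, (if s a ∈ B then (1 - c) * f {s a} else 0) =
      (1 - c) * ∑ x ∈ B ∩ O, f {x} := by
    rw [← Finset.sum_image (f := fun x => if x ∈ B then (1 - c) * f {x} else 0) hinj, ← hO,
      ← Finset.sum_filter, Finset.filter_mem_eq_inter, Finset.mul_sum, Finset.inter_comm]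
  rw [e1, e2]
  have h1 := hf.union_sub_le_sum hm B O
  have h2 := hcurv.le_union_sub (Finset.sdiff_disjoint (s := O) (t := B))
  rw [Finset.union_sdiff_self_eq_union, Finset.union_comm] at h2
  have h3 := hf.le_sum_singleton hm h0 B
  have h4 : ∑ x ∈ B, f {x} = ∑ x ∈ B ∩ O, f {x} + ∑ x ∈ B \ O, f {x} :=
    (Finset.sum_inter_add_sum_sdiff B O _).symm
  have h5 := mul_le_mul_of_nonneg_left h3 (sub_nonneg.mpr hc1)
  rw [h4, mul_add] at h5
  linarith

/-- The total loss in potential along a family of swaps from `A` to `s(A)` is controlled by the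
values of the objective function at the two sets. -/
theorem sum_potential_swap_le (hf : IsSubmodular f) (hm : Monotone f) (h0 : IsNormalized f)
    (hcurv : HasCurvature f c) (hc : 0 < c) (hc1 : c ≤ 1) {A : Finset U} (s : U → U)
    (hinj : Set.InjOn s A) (hs : ∀ a ∈ A, s a ∉ A ∨ s a = a) :
    ∑ a ∈ A, (potential c f A - potential c f (insert (s a) (A.erase a))) ≤
      density c 1 * f A - f (A.image s) := by
  have h1 : ∀ a ∈ A, potential c f A - potential c f (insert (s a) (A.erase a)) =
      meanMarginal c f (A.erase a) a - ∑ B ∈ A.powerset,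
        mcoeff c A.card B.card * (f (insert (s a) (B.erase a)) - f (B.erase a)) := by
    intro a ha
    have e1 := potential_insert (c := c) h0 (Finset.notMem_erase a A)
    rw [Finset.insert_erase ha] at e1
    have e2 : potential c f (insert (s a) (A.erase a)) =
        potential c f (A.erase a) + meanMarginal c f (A.erase a) (s a) := by
      refine potential_insert h0 fun h => ?_
      rcases hs a ha with h' | h'
      · exact h' (Finset.mem_of_mem_erase h)
      · exact (Finset.ne_of_mem_erase h) h'
    have e3 := sum_powerset_erase (c := c) ha fun B => f (insert (s a) B) - f B
    rw [e1, e2, e3]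
    unfold meanMarginal
    ring
  rw [Finset.sum_congr rfl h1, Finset.sum_sub_distrib, Finset.sum_comm (s := A) (t := A.powerset)]
  have h2 : ∑ B ∈ A.powerset, mcoeff c A.card B.card * (f (A.image s) - c * f B) ≤
      ∑ B ∈ A.powerset, ∑ a ∈ A,
        mcoeff c A.card B.card * (f (insert (s a) (B.erase a)) - f (B.erase a)) := by
    refine Finset.sum_le_sum fun B hB => ?_
    rw [← Finset.mul_sum]
    exact mul_le_mul_of_nonneg_left (sub_le_sum_erase hf hm h0 hcurv hc1
      (Finset.mem_powerset.mp hB) s hinj hs) (mcoeff_nonneg _ _ _)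
  have h3 : ∑ B ∈ A.powerset, mcoeff c A.card B.card * (f (A.image s) - c * f B) =
      f (A.image s) - c * ∑ B ∈ A.powerset, mcoeff c A.card B.card * f B := by
    simp only [mul_sub]
    rw [Finset.sum_sub_distrib, ← Finset.sum_mul, sum_mcoeff hc, one_mul, Finset.mul_sum]
    congr 1
    exact Finset.sum_congr rfl fun B _ => by ring
  linarith [sum_meanMarginal_self (c := c) h0 A]

end Potential

/-! ### Matroid exchange and the approximate greedy algorithm. -/

section Matroid

variable {U : Type u} [DecidableEq U] {M : Matroid U}

/-- If no element of `T` can be exchanged for `x`, then `x` is spanned by the rest of the base. -/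
theorem exists_exchange_of_indep_insert {A T : Finset U} (hA : M.IsBase (A : Set U))
    {x : U} (hx : x ∉ A) (h : M.Indep (insert x (A \ T) : Finset U)) :
    ∃ a ∈ T, M.Indep (insert x (A.erase a) : Finset U) := by
  -- Extend A \ T + x to a base B inside its union with A. As |B| = |A| and x ∈ B, some a ∈ A is
  -- missing from B. It must lie in T, and counting gives B = A - a + x.
  obtain ⟨B, hB, hIB, hBA⟩ := h.exists_isBase_subset_union_isBase hA
  have hfin : B.Finite := ((Finset.finite_toSet _).union (Finset.finite_toSet A)).subset hBA
  lift B to Finset U using hfin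
  have hcard : B.card = A.card := by
    simpa using hB.ncard_eq_ncard_of_isBase hA
  rw [← Finset.coe_union, Finset.coe_subset] at hBA
  rw [Finset.coe_subset] at hIB
  have hxB : x ∈ B := hIB (Finset.mem_insert_self _ _)
  have hnot : ¬ A ⊆ B := fun hAB => hx (Finset.eq_of_subset_of_card_le hAB hcard.le ▸ hxB)
  obtain ⟨a, haA, haB⟩ := Finset.not_subset.mp hnot
  have haT : a ∈ T := by
    by_contra haT
    exact haB (hIB (by simp [haA, haT]))
  refine ⟨a, haT, ?_⟩
  have : B = insert x (A.erase a) := by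
    refine Finset.eq_of_subset_of_card_le (fun y hy => ?_) ?_
    · have hya : y ≠ a := fun h => haB (h ▸ hy)
      have := hBA hy
      simp only [Finset.mem_union, Finset.mem_insert, Finset.mem_sdiff, Finset.mem_erase] at this ⊢
      tauto
    · rw [hcard]
      refine (Finset.card_insert_le _ _).trans ?_
      rw [Finset.card_erase_of_mem haA]
      have := Finset.card_pos.mpr ⟨a, haA⟩
      omega
  rw [← this]
  exact hB.indep

/-- Any two bases of a matroid are matched by a bijection of feasible swaps which fixes their
common elements (Brualdi). -/
theorem exists_swap_bijection {A O : Finset U} (hA : M.IsBase (A : Set U))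
    (hO : M.IsBase (O : Set U)) :
    ∃ s : U → U, Set.InjOn s A ∧ A.image s = O ∧ (∀ a ∈ A, s a ∉ A ∨ s a = a) ∧
      ∀ a ∈ A, M.Indep (insert (s a) (A.erase a) : Finset U) := by
  classical
  have hcard : A.card = O.card := by simpa using hA.ncard_eq_ncard_of_isBase hO
  let t : {a // a ∈ A \ O} → Finset U := fun a =>
    (O \ A).filter fun x => M.Indep (insert x (A.erase a) : Finset U)
  -- Hall's condition for the graph of feasible swaps. If R had too few neighbours, A \ R would be
  -- smaller than O without those neighbours; augmentation gives an x in the latter, and the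
  -- exchange lemma makes x a neighbour of R after all.
  have hall : ∀ R : Finset {a // a ∈ A \ O}, R.card ≤ (R.biUnion t).card := by
    intro R
    by_contra! hlt
    set T : Finset U := R.map (Function.Embedding.subtype _) with hTdef
    have hTA : T ⊆ A \ O := by
      intro a ha
      obtain ⟨b, _, rfl⟩ := Finset.mem_map.mp ha
      exact b.2
    have hTA' : T ⊆ A := hTA.trans Finset.sdiff_subset
    have hTcard : T.card = R.card := Finset.card_map _
    have hN : R.biUnion t ⊆ O := Finset.biUnion_subset.mpr fun a _ =>
      (Finset.filter_subset _ _).trans Finset.sdiff_subset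
    have hI : M.Indep (A \ T : Finset U) := hA.indep.subset (by simp)
    have hJ : M.Indep (O \ R.biUnion t : Finset U) :=
      hO.indep.subset (Finset.coe_subset.mpr Finset.sdiff_subset)
    have hcards : ((A \ T : Finset U) : Set U).encard <
        ((O \ R.biUnion t : Finset U) : Set U).encard := by
      rw [Set.encard_coe_eq_coe_finsetCard, Set.encard_coe_eq_coe_finsetCard,
        Finset.card_sdiff_of_subset hTA', Finset.card_sdiff_of_subset hN]
      have := Finset.card_le_card hTA'
      exact_mod_cast (by omega)
    obtain ⟨x, hx, hxI⟩ := hI.augment hJ hcards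
    rw [← Finset.coe_sdiff, Finset.mem_coe, Finset.mem_sdiff, Finset.mem_sdiff] at hx
    have hxA : x ∉ A := fun hxA => hx.2 (Finset.mem_sdiff.mpr
      ⟨hxA, fun h => (Finset.mem_sdiff.mp (hTA h)).2 hx.1.1⟩)
    rw [← Finset.coe_insert] at hxI
    obtain ⟨a, haT, ha⟩ := exists_exchange_of_indep_insert hA hxA hxI
    obtain ⟨b, hb, rfl⟩ := Finset.mem_map.mp haT
    exact hx.1.2 (Finset.mem_biUnion.mpr
      ⟨b, hb, Finset.mem_filter.mpr ⟨Finset.mem_sdiff.mpr ⟨hx.1.1, hxA⟩, ha⟩⟩)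
  obtain ⟨φ, hφinj, hφ⟩ := (Finset.all_card_le_biUnion_card_iff_exists_injective t).mp hall
  let s : U → U := fun a => if h : a ∈ A \ O then φ ⟨a, h⟩ else a
  have hs1 : ∀ a (h : a ∈ A \ O), s a = φ ⟨a, h⟩ := fun a h => dif_pos h
  have hs2 : ∀ a, a ∉ A \ O → s a = a := fun a h => dif_neg h
  have hmem : ∀ a ∈ A \ O, s a ∈ O \ A := fun a h => by
    rw [hs1 a h]
    exact (Finset.mem_filter.mp (hφ ⟨a, h⟩)).1
  have hinj : Set.InjOn s A := by
    intro a ha b hb hab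
    by_cases h1 : a ∈ A \ O <;> by_cases h2 : b ∈ A \ O
    · rw [hs1 a h1, hs1 b h2] at hab
      exact congrArg Subtype.val (hφinj hab)
    · have := hmem a h1
      rw [hab, hs2 b h2] at this
      exact absurd hb (Finset.mem_sdiff.mp this).2
    · have := hmem b h2
      rw [← hab, hs2 a h1] at this
      exact absurd ha (Finset.mem_sdiff.mp this).2
    · rwa [hs2 a h1, hs2 b h2] at hab
  refine ⟨s, hinj, ?_, ?_, ?_⟩
  · refine Finset.eq_of_subset_of_card_le (Finset.image_subset_iff.mpr fun a ha => ?_) ?_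
    · by_cases h : a ∈ A \ O
      · exact (Finset.mem_sdiff.mp (hmem a h)).1
      · rw [hs2 a h]
        by_contra h'
        exact h (Finset.mem_sdiff.mpr ⟨ha, h'⟩)
    · rw [Finset.card_image_of_injOn hinj, hcard]
  · intro a _
    by_cases h : a ∈ A \ O
    · exact Or.inl (Finset.mem_sdiff.mp (hmem a h)).2
    · exact Or.inr (hs2 a h)
  · intro a ha
    by_cases h : a ∈ A \ O
    · rw [hs1 a h]
      exact (Finset.mem_filter.mp (hφ ⟨a, h⟩)).2
    · rw [hs2 a h, Finset.insert_erase ha]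
      exact hA.indep

/-- Sets built by a greedy algorithm whose comparisons of values of `g` are accurate up to the
factor `(1 + δ) / (1 - δ)`. -/
inductive ApproxGreedy (M : Matroid U) (g : Finset U → ℝ) (δ : ℝ) : Finset U → Prop
  | nil : ApproxGreedy M g δ ∅
  | cons {S : Finset U} {x : U} : ApproxGreedy M g δ S → x ∉ S →
      M.Indep (insert x S : Finset U) →
      (∀ y, y ∉ S → M.Indep (insert y S : Finset U) →
        (1 - δ) * g (insert y S) ≤ (1 + δ) * g (insert x S)) →
      ApproxGreedy M g δ (insert x S)

theorem ApproxGreedy.indep {g : Finset U → ℝ} {δ : ℝ} {S : Finset U}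
    (h : ApproxGreedy M g δ S) : M.Indep (S : Set U) := by
  cases h with
  | nil => simp
  | cons _ _ h _ => exact h

/-- Induction along the greedy order. When x was chosen, s(x) was also a feasible candidate, because
swapping x for s(x) in S + x gives S + s(x). Hence g(S + s(x)) exceeds g(S + x) by a factor of at
most 1 + 2δ/(1 - δ), and the marginals of the earlier s(a) only shrink as the set grows. -/
theorem ApproxGreedy.sum_marginal_le {g : Finset U → ℝ} {δ : ℝ} {S : Finset U}
    (h : ApproxGreedy M g δ S) (hδ0 : 0 ≤ δ) (hδ1 : δ < 1) (hm : Monotone g) (h0 : g ∅ = 0)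
    (hsub : ∀ A B : Finset U, A ⊆ B → ∀ x, g (insert x B) - g B ≤ g (insert x A) - g A)
    (s : U → U) (hs : ∀ a ∈ S, s a ∉ S ∨ s a = a)
    (hind : ∀ a ∈ S, M.Indep (insert (s a) (S.erase a) : Finset U)) :
    ∑ a ∈ S, (g (insert (s a) S) - g S) ≤ (1 + S.card * (2 * δ / (1 - δ))) * g S := by
  induction h with
  | nil => simp [h0]
  | @cons S x hS hx hxS hbest ih =>
    have ih' := ih (fun a ha => (hs a (Finset.mem_insert_of_mem ha)).imp_left
      fun h h' => h (Finset.mem_insert_of_mem h')) fun a ha =>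
        (hind a (Finset.mem_insert_of_mem ha)).subset (by
          gcongr
          exact Finset.subset_insert _ _)
    have hsx : s x ∉ S := by
      rcases hs x (Finset.mem_insert_self x S) with h | h
      · exact fun h' => h (Finset.mem_insert_of_mem h')
      · rwa [h]
    have hsxi : M.Indep (insert (s x) S : Finset U) := by
      have := hind x (Finset.mem_insert_self x S)
      rwa [Finset.erase_insert hx] at this
    have h1 := hbest (s x) hsx hsxi
    have hη : 0 ≤ 2 * δ / (1 - δ) := by
      have : 0 < 1 - δ := by linarith
      positivity
    have h2 : g (insert (s x) S) ≤ (1 + 2 * δ / (1 - δ)) * g (insert x S) := by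
      have hpos : 0 < 1 - δ := by linarith
      have e : (1 + 2 * δ / (1 - δ)) * g (insert x S) = (1 + δ) * g (insert x S) / (1 - δ) := by
        field_simp
        ring
      rw [e, le_div_iff₀ hpos]
      linarith
    have hgS : g S ≤ g (insert x S) := hm (Finset.subset_insert _ _)
    have hg0 : 0 ≤ g S := h0.symm.le.trans (hm (Finset.empty_subset S))
    rw [Finset.sum_insert hx, Finset.card_insert_of_notMem hx]
    have h3 : ∑ a ∈ S, (g (insert (s a) (insert x S)) - g (insert x S)) ≤
        ∑ a ∈ S, (g (insert (s a) S) - g S) :=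
      Finset.sum_le_sum fun a _ => hsub _ _ (Finset.subset_insert x S) _
    have h4 := hsub _ _ (Finset.subset_insert x S) (s x)
    have h5 := mul_le_mul_of_nonneg_left hgS
      (mul_nonneg (Nat.cast_nonneg (α := ℝ) S.card) hη)
    push_cast
    nlinarith

/-- The approximate greedy algorithm is a `1 / (2 + 3 r δ)`-approximation. -/
theorem ApproxGreedy.le_mul {g : Finset U → ℝ} {δ : ℝ} {S O : Finset U}
    (h : ApproxGreedy M g δ S) (hδ0 : 0 ≤ δ) (hδ1 : δ ≤ 1 / 3) (hm : Monotone g) (h0 : g ∅ = 0)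
    (hsub : ∀ A B : Finset U, A ⊆ B → ∀ x, g (insert x B) - g B ≤ g (insert x A) - g A)
    (hS : M.IsBase (S : Set U)) (hO : M.IsBase (O : Set U)) :
    g O ≤ (2 + 3 * S.card * δ) * g S := by
  obtain ⟨s, hinj, himg, hs, hind⟩ := exists_swap_bijection hS hO
  have h1 := h.sum_marginal_le hδ0 (by linarith) hm h0 hsub s hs hind
  have h2 : ∀ D : Finset U, g (S ∪ D) - g S ≤ ∑ x ∈ D, (g (insert x S) - g S) := by
    intro D
    induction D using Finset.induction_on with
    | empty => simp
    | insert x D hx ih =>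
      rw [Finset.sum_insert hx, Finset.union_insert]
      have := hsub _ _ (Finset.subset_union_left (s₁ := S) (s₂ := D)) x
      linarith
  have h3 := h2 O
  rw [← himg, Finset.sum_image hinj, himg] at h3
  have h4 : g O ≤ g (S ∪ O) := hm Finset.subset_union_right
  have hg0 : 0 ≤ g S := h0.symm.le.trans (hm (Finset.empty_subset S))
  have h5 : 2 * δ / (1 - δ) ≤ 3 * δ := by
    rw [div_le_iff₀ (by linarith)]
    nlinarith
  have h6 := mul_le_mul_of_nonneg_right
    (mul_le_mul_of_nonneg_left h5 (Nat.cast_nonneg (α := ℝ) S.card)) hg0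
  linarith

end Matroid

/-! ### Program logic: expectations, failure probabilities and worst-case step counts. -/

open scoped ENNReal

namespace Prog

variable {U : Type u} {α : Type v} {β : Type w} {M : Matroid U} {f : Finset U → ℝ}

open scoped Classical in
/-- The expected value of `φ` at the output of a program on the instance `(M, f)`. -/
noncomputable def expect (M : Matroid U) (f : Finset U → ℝ) :
    Prog U α → (α → ℝ≥0∞) → ℝ≥0∞
  | done a, φ => φ a
  | step k, φ => expect M f k φ
  | member B k, φ => expect M f (k (decide (M.Indep (B : Set U)))) φ
  | value B k, φ => expect M f (k (f B)) φ
  | sample μ k, φ => ∑' B, μ B * expect M f (k B) φ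

theorem expect_bind (p : Prog U α) (q : α → Prog U β) (φ : β → ℝ≥0∞) :
    expect M f (p.bind q) φ = expect M f p fun a => expect M f (q a) φ := by
  induction p with
  | done a => rfl
  | step k ih => exact ih
  | member B k ih => exact ih _
  | value B k ih => exact ih _
  | sample μ k ih => exact tsum_congr fun B => by rw [ih B]

theorem expect_mono (p : Prog U α) {φ ψ : α → ℝ≥0∞} (h : ∀ a, φ a ≤ ψ a) :
    expect M f p φ ≤ expect M f p ψ := by
  induction p with
  | done a => exact h a
  | step k ih => exact ih
  | member B k ih => exact ih _
  | value B k ih => exact ih _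
  | sample μ k ih =>
    exact ENNReal.tsum_le_tsum fun B => mul_le_mul_right (ih B) _

theorem expect_add (p : Prog U α) (φ ψ : α → ℝ≥0∞) :
    expect M f p (fun a => φ a + ψ a) = expect M f p φ + expect M f p ψ := by
  induction p with
  | done a => rfl
  | step k ih => exact ih
  | member B k ih => exact ih _
  | value B k ih => exact ih _
  | sample μ k ih =>
    simp only [expect, ih, mul_add]
    exact ENNReal.tsum_add

theorem expect_const (p : Prog U α) (b : ℝ≥0∞) : expect M f p (fun _ => b) = b := by
  induction p with
  | done a => rfl
  | step k ih => exact ih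
  | member B k ih => exact ih _
  | value B k ih => exact ih _
  | sample μ k ih =>
    simp only [expect, ih]
    rw [ENNReal.tsum_mul_right, μ.tsum_coe, one_mul]

theorem expect_const_mul (p : Prog U α) (b : ℝ≥0∞) (φ : α → ℝ≥0∞) :
    expect M f p (fun a => b * φ a) = b * expect M f p φ := by
  induction p with
  | done a => rfl
  | step k ih => exact ih
  | member B k ih => exact ih _
  | value B k ih => exact ih _
  | sample μ k ih =>
    simp only [expect, ih]
    rw [← ENNReal.tsum_mul_left]
    exact tsum_congr fun B => by ring

open scoped Classical in
/-- The probability that the output of a program does not satisfy `Q` is at most `δ`. -/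
def FailsLE (M : Matroid U) (f : Finset U → ℝ) (p : Prog U α) (Q : α → Prop) (δ : ℝ≥0∞) : Prop :=
  expect M f p (fun a => if Q a then 0 else 1) ≤ δ

/-- Connects the recursive `expect`, in which all probability bounds are derived, with the law of
output and time. -/
theorem toOuterMeasure_run (p : Prog U α) (Q : α → Prop) [DecidablePred Q] :
    (p.run M f).toOuterMeasure {z | Q z.1} = expect M f p fun a => if Q a then 1 else 0 := by
  induction p with
  | done a =>
    simp only [run, expect, PMF.toOuterMeasure_pure_apply, Set.mem_ofPred_eq]
    congr
  | step k ih => simpa [run, expect, PMF.toOuterMeasure_map_apply] using ih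
  | member B k ih => simpa [run, expect, PMF.toOuterMeasure_map_apply] using ih _
  | value B k ih => simpa [run, expect, PMF.toOuterMeasure_map_apply] using ih _
  | sample μ k ih =>
    simp only [run, expect, PMF.toOuterMeasure_bind_apply]
    refine tsum_congr fun B => ?_
    rw [← ih B, PMF.toOuterMeasure_map_apply]
    rfl

/-- A bound on the failure probability is a lower bound on the success probability. -/
theorem FailsLE.one_sub_le {p : Prog U α} {Q : α → Prop} {δ : ℝ} (hδ : 0 ≤ δ)
    (h : FailsLE M f p Q (ENNReal.ofReal δ)) :
    1 - δ ≤ ((p.run M f).toOuterMeasure {z | Q z.1}).toReal := by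
  classical
  rw [toOuterMeasure_run]
  unfold FailsLE at h
  have h1 : expect M f p (fun a => if Q a then 1 else 0) +
      expect M f p (fun a => if Q a then 0 else 1) = 1 := by
    rw [← expect_add]
    refine Eq.trans ?_ (expect_const (M := M) (f := f) p 1)
    congr
    funext a
    split_ifs <;> simp
  have hfin : expect M f p (fun a => if Q a then 1 else 0) ≠ ∞ := fun h' => by simp [h'] at h1
  have h2 : (1 : ℝ≥0∞) ≤
      expect M f p (fun a => if Q a then 1 else 0) + ENNReal.ofReal δ := by
    conv_lhs => rw [← h1]
    gcongr
  have h3 := ENNReal.toReal_mono (ENNReal.add_ne_top.mpr ⟨hfin, ENNReal.ofReal_ne_top⟩) h2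
  rw [ENNReal.toReal_add hfin ENNReal.ofReal_ne_top, ENNReal.toReal_ofReal hδ,
    ENNReal.toReal_one] at h3
  linarith

theorem FailsLE.done {a : α} {Q : α → Prop} (h : Q a) (δ : ℝ≥0∞) :
    FailsLE M f (done a) Q δ := by
  simp [FailsLE, expect, h]

theorem FailsLE.mono {p : Prog U α} {Q Q' : α → Prop} {δ δ' : ℝ≥0∞} (h : FailsLE M f p Q δ)
    (hQ : ∀ a, Q a → Q' a) (hδ : δ ≤ δ') : FailsLE M f p Q' δ' := by
  refine le_trans (expect_mono p fun a => ?_) (h.trans hδ)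
  by_cases h1 : Q a
  · simp [h1, hQ a h1]
  · by_cases h2 : Q' a <;> simp [h1, h2]

/-- The union bound for sequential composition. -/
theorem FailsLE.bind {p : Prog U α} {q : α → Prog U β} {P : α → Prop} {Q : β → Prop}
    {δ δ' : ℝ≥0∞} (hp : FailsLE M f p P δ) (hq : ∀ a, P a → FailsLE M f (q a) Q δ') :
    FailsLE M f (p.bind q) Q (δ + δ') := by
  classical
  unfold FailsLE at *
  rw [expect_bind]
  calc expect M f p (fun a => expect M f (q a) fun b => if Q b then 0 else 1)
      ≤ expect M f p (fun a => (if P a then 0 else 1) + δ') := by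
        refine expect_mono p fun a => ?_
        by_cases ha : P a
        · simpa [ha] using hq a ha
        · rw [if_neg ha]
          refine le_trans ?_ le_self_add
          refine (expect_mono (q a) (ψ := fun _ => 1) fun b => ?_).trans (expect_const _ _).le
          split_ifs <;> simp
    _ = expect M f p (fun a => if P a then 0 else 1) + δ' := by
        rw [expect_add, expect_const]
    _ ≤ δ + δ' := by gcongr

/-- On every branch, the program stops within the given number of steps, with an output that
satisfies `Q`. -/
inductive HaltsWithin (Q : α → Prop) : ℕ → Prog U α → Prop
  | done {a : α} (T : ℕ) : Q a → HaltsWithin Q T (done a)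
  | step {k : Prog U α} {T : ℕ} : HaltsWithin Q T k → HaltsWithin Q (T + 1) (step k)
  | member {B : Finset U} {k : Bool → Prog U α} {T : ℕ} :
      (∀ b, HaltsWithin Q T (k b)) → HaltsWithin Q (T + 1) (member B k)
  | value {B : Finset U} {k : ℝ → Prog U α} {T : ℕ} :
      (∀ y, HaltsWithin Q T (k y)) → HaltsWithin Q (T + 1) (value B k)
  | sample {μ : PMF (Finset U)} {k : Finset U → Prog U α} {T : ℕ} :
      (∀ B, HaltsWithin Q T (k B)) → HaltsWithin Q (T + 1) (sample μ k)

theorem HaltsWithin.mono {Q : α → Prop} {T T' : ℕ} {p : Prog U α} (h : HaltsWithin Q T p)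
    (hT : T ≤ T') : HaltsWithin Q T' p := by
  induction h generalizing T' with
  | done T h => exact .done T' h
  | step _ ih =>
    obtain ⟨S, rfl⟩ := Nat.exists_eq_add_of_le' (Nat.one_le_of_lt hT)
    exact .step (ih (Nat.le_of_succ_le_succ hT))
  | member _ ih =>
    obtain ⟨S, rfl⟩ := Nat.exists_eq_add_of_le' (Nat.one_le_of_lt hT)
    exact .member fun b => ih b (Nat.le_of_succ_le_succ hT)
  | value _ ih =>
    obtain ⟨S, rfl⟩ := Nat.exists_eq_add_of_le' (Nat.one_le_of_lt hT)
    exact .value fun b => ih b (Nat.le_of_succ_le_succ hT)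
  | sample _ ih =>
    obtain ⟨S, rfl⟩ := Nat.exists_eq_add_of_le' (Nat.one_le_of_lt hT)
    exact .sample fun b => ih b (Nat.le_of_succ_le_succ hT)

theorem HaltsWithin.bind {P : α → Prop} {Q : β → Prop} {T T' : ℕ} {p : Prog U α}
    {q : α → Prog U β} (hp : HaltsWithin P T p) (hq : ∀ a, P a → HaltsWithin Q T' (q a)) :
    HaltsWithin Q (T + T') (p.bind q) := by
  induction hp with
  | done T h => exact (hq _ h).mono (Nat.le_add_left _ _)
  | step _ ih => exact (HaltsWithin.step ih).mono (by omega)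
  | member _ ih => exact (HaltsWithin.member ih).mono (by omega)
  | value _ ih => exact (HaltsWithin.value ih).mono (by omega)
  | sample _ ih => exact (HaltsWithin.sample ih).mono (by omega)

theorem HaltsWithin.le_of_mem_support {Q : α → Prop} {T : ℕ} {p : Prog U α}
    (h : HaltsWithin Q T p) {z : α × ℕ} (hz : z ∈ (p.run M f).support) : z.2 ≤ T := by
  induction h generalizing z with
  | done T h =>
    simp only [run, PMF.support_pure, Set.mem_singleton_iff] at hz
    simp [hz]
  | step _ ih =>
    simp only [run, PMF.support_map, Set.mem_image] at hz
    obtain ⟨y, hy, rfl⟩ := hz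
    exact Nat.succ_le_succ (ih hy)
  | member _ ih =>
    simp only [run, PMF.support_map, Set.mem_image] at hz
    obtain ⟨y, hy, rfl⟩ := hz
    exact Nat.succ_le_succ (ih _ hy)
  | value _ ih =>
    simp only [run, PMF.support_map, Set.mem_image] at hz
    obtain ⟨y, hy, rfl⟩ := hz
    exact Nat.succ_le_succ (ih _ hy)
  | sample _ ih =>
    simp only [run, PMF.mem_support_bind_iff, PMF.support_map, Set.mem_image] at hz
    obtain ⟨B, _, y, hy, rfl⟩ := hz
    exact Nat.succ_le_succ (ih _ hy)

end Prog

/-! ### Concentration of the sample sums. -/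

namespace LocalSearch

open Prog

variable {U : Type u} {M : Matroid U} {f : Finset U → ℝ}

/-- Independence of the draws enters here: the exponential moment is a product over the draws. -/
theorem expect_sampleSum_exp (μ : PMF (Finset U)) (l : ℝ) (k : ℕ) (acc : ℝ) :
    expect M f (sampleSum μ k acc) (fun s => ENNReal.ofReal (Real.exp (l * s))) =
      ENNReal.ofReal (Real.exp (l * acc)) *
        (∑' B, μ B * ENNReal.ofReal (Real.exp (l * f B))) ^ k := by
  induction k generalizing acc with
  | zero => simp [sampleSum, expect]
  | succ k ih =>
    simp only [sampleSum, expect, ih]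
    rw [pow_succ', ← mul_assoc, ← ENNReal.tsum_mul_left, ← ENNReal.tsum_mul_right]
    refine tsum_congr fun B => ?_
    rw [mul_add, Real.exp_add, ENNReal.ofReal_mul (Real.exp_pos _).le]
    ring

theorem expect_sampleSum_of_zero {μ : PMF (Finset U)} (h : ∀ B ∈ μ.support, f B = 0) (k : ℕ)
    (acc : ℝ) (φ : ℝ → ℝ≥0∞) : expect M f (sampleSum μ k acc) φ = φ acc := by
  induction k generalizing acc with
  | zero => rfl
  | succ k ih =>
    simp only [sampleSum, expect, ih]
    have : ∀ B, μ B * φ (acc + f B) = μ B * φ acc := fun B => by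
      by_cases hB : μ B = 0
      · simp [hB]
      · rw [h B ((μ.mem_support_iff B).mpr hB), add_zero]
    rw [tsum_congr this, ENNReal.tsum_mul_right, μ.tsum_coe, one_mul]

/-- Hoeffding's lemma for a probability distribution on a finite type. -/
theorem tsum_mul_exp_le {ι : Type u} [Fintype ι] (μ : PMF ι) (X : ι → ℝ) {L : ℝ} (hL : 0 ≤ L)
    (hX : ∀ i ∈ μ.support, X i ∈ Set.Icc 0 L) (l : ℝ) :
    ∑' i, μ i * ENNReal.ofReal (Real.exp (l * X i)) ≤
      ENNReal.ofReal (Real.exp (l * (∑ i, (μ i).toReal * X i) + l ^ 2 * L ^ 2 / 8)) := by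
  let _ : MeasurableSpace ι := ⊤
  have hmean : ∫ i, X i ∂μ.toMeasure = ∑ i, (μ i).toReal * X i := by
    rw [PMF.integral_eq_sum]
    simp [smul_eq_mul]
  have hae : ∀ᵐ i ∂μ.toMeasure, X i ∈ Set.Icc 0 L := by
    rw [MeasureTheory.ae_iff, PMF.toMeasure_apply_eq_zero_iff _ (by trivial)]
    exact Set.disjoint_left.mpr fun i hi h => h (hX i hi)
  have h := (ProbabilityTheory.hasSubgaussianMGF_of_mem_Icc (μ := μ.toMeasure)
    (X := X) (measurable_from_top.aemeasurable) hae).mgf_le l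
  rw [ProbabilityTheory.mgf, PMF.integral_eq_sum, hmean] at h
  set E := ∑ i, (μ i).toReal * X i
  have e1 : ∑' i, μ i * ENNReal.ofReal (Real.exp (l * X i)) =
      ENNReal.ofReal (∑ i, (μ i).toReal * Real.exp (l * X i)) := by
    rw [tsum_fintype, ENNReal.ofReal_sum_of_nonneg fun i _ => by positivity]
    refine Finset.sum_congr rfl fun i _ => ?_
    rw [ENNReal.ofReal_mul ENNReal.toReal_nonneg, ENNReal.ofReal_toReal (μ.apply_ne_top i)]
  rw [e1]
  refine ENNReal.ofReal_le_ofReal ?_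
  have e2 : ∑ i, (μ i).toReal * Real.exp (l * X i) =
      Real.exp (l * E) * ∑ i, (μ i).toReal • Real.exp (l * (X i - E)) := by
    rw [Finset.mul_sum]
    refine Finset.sum_congr rfl fun i _ => ?_
    rw [mul_sub, Real.exp_sub, smul_eq_mul]
    field_simp
  rw [e2, Real.exp_add]
  refine mul_le_mul_of_nonneg_left (h.trans (Real.exp_le_exp.mpr (le_of_eq ?_)))
    (Real.exp_pos _).le
  push_cast
  rw [sub_zero, Real.norm_eq_abs, abs_of_nonneg hL]
  ring

/-- Hoeffding's inequality for the sum of `k` independent samples. -/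
theorem failsLE_sampleSum [Fintype U] (μ : PMF (Finset U)) {L : ℝ} (hL : 0 < L)
    (hf : ∀ B ∈ μ.support, f B ∈ Set.Icc 0 L) (k : ℕ) {x : ℝ} (hx : 0 ≤ x) :
    FailsLE M f (sampleSum μ k 0)
      (fun s => |s - k * ∑ B, (μ B).toReal * f B| ≤ k * x * L)
      (ENNReal.ofReal (2 * Real.exp (-2 * k * x ^ 2))) := by
  classical
  set E := ∑ B, (μ B).toReal * f B
  -- Chernoff's method at the optimal l = ±4x/L. The moment bound contributes k l²L²/8 = 2kx² to the
  -- exponent and the threshold contributes -4kx². Fixing only l² treats both tails at once.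
  have tail : ∀ l : ℝ, l ^ 2 = (4 * x / L) ^ 2 →
      expect M f (sampleSum μ k 0) (fun s =>
        ENNReal.ofReal (Real.exp (- l * (k * E) - 4 * k * x ^ 2)) *
          ENNReal.ofReal (Real.exp (l * s))) ≤ ENNReal.ofReal (Real.exp (-2 * k * x ^ 2)) := by
    intro l hl
    rw [expect_const_mul, expect_sampleSum_exp]
    simp only [mul_zero, Real.exp_zero, ENNReal.ofReal_one, one_mul]
    calc _ ≤ ENNReal.ofReal (Real.exp (- l * (k * E) - 4 * k * x ^ 2)) *
          (ENNReal.ofReal (Real.exp (l * E + l ^ 2 * L ^ 2 / 8))) ^ k := by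
            gcongr
            exact tsum_mul_exp_le μ f hL.le hf l
      _ = ENNReal.ofReal (Real.exp (-2 * k * x ^ 2)) := by
            rw [← ENNReal.ofReal_pow (Real.exp_pos _).le, ← Real.exp_nat_mul,
              ← ENNReal.ofReal_mul (Real.exp_pos _).le, ← Real.exp_add, hl]
            congr 2
            field_simp
            ring
  have hsplit : ∀ s : ℝ, (if |s - k * E| ≤ k * x * L then (0 : ℝ≥0∞) else 1) ≤
      ENNReal.ofReal (Real.exp (- (4 * x / L) * (k * E) - 4 * k * x ^ 2)) *
          ENNReal.ofReal (Real.exp ((4 * x / L) * s)) +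
      ENNReal.ofReal (Real.exp (- (-(4 * x / L)) * (k * E) - 4 * k * x ^ 2)) *
          ENNReal.ofReal (Real.exp (-(4 * x / L) * s)) := by
    intro s
    split_ifs with h
    · exact zero_le
    rw [← ENNReal.ofReal_mul (Real.exp_pos _).le, ← ENNReal.ofReal_mul (Real.exp_pos _).le,
      ← Real.exp_add, ← Real.exp_add]
    have key : ∀ d : ℝ, k * x * L < d →
        (1 : ℝ≥0∞) ≤ ENNReal.ofReal (Real.exp (4 * x / L * d - 4 * k * x ^ 2)) := by
      intro d hd
      rw [ENNReal.one_le_ofReal, Real.one_le_exp_iff]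
      have h1 := mul_le_mul_of_nonneg_left hd.le (show 0 ≤ 4 * x / L by positivity)
      have h2 : 4 * x / L * (k * x * L) = 4 * k * x ^ 2 := by
        field_simp
      linarith
    rcases lt_abs.mp (not_le.mp h) with h' | h'
    · refine le_trans ((key _ h').trans (le_of_eq ?_)) le_self_add
      congr 2
      ring
    · refine le_trans ((key _ h').trans (le_of_eq ?_)) le_add_self
      congr 2
      ring
  refine (expect_mono _ hsplit).trans ?_
  rw [expect_add, two_mul, ENNReal.ofReal_add (Real.exp_pos _).le (Real.exp_pos _).le]
  exact add_le_add (tail _ rfl) (tail _ (by ring))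

end LocalSearch

/-! ### Failure rules for elementary steps and membership queries. -/

namespace Prog

variable {U : Type u} {α : Type v} {M : Matroid U} {f : Finset U → ℝ}

theorem FailsLE.step {p : Prog U α} {Q : α → Prop} {δ : ℝ≥0∞} (h : FailsLE M f p Q δ) :
    FailsLE M f (Prog.step p) Q δ := h

theorem FailsLE.member {B : Finset U} {k : Bool → Prog U α} {Q : α → Prop} {δ : ℝ≥0∞}
    (h1 : M.Indep (B : Set U) → FailsLE M f (k true) Q δ)
    (h2 : ¬ M.Indep (B : Set U) → FailsLE M f (k false) Q δ) :
    FailsLE M f (Prog.member B k) Q δ := by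
  by_cases h : M.Indep (B : Set U)
  · have := h1 h
    unfold FailsLE at this ⊢
    simpa [expect, h] using this
  · have := h2 h
    unfold FailsLE at this ⊢
    simpa [expect, h] using this

end Prog

open Prog

/-! ### Bases as independent sets of size r. -/

section Rank

variable {U : Type u} {M : Matroid U} {r : ℕ}

theorem isBase_card (hr : M.eRank = (r : ℕ∞)) {S : Finset U} (hS : M.IsBase (S : Set U)) :
    S.card = r := by
  have := hS.encard_eq_eRank
  rw [hr, Set.encard_coe_eq_coe_finsetCard] at this
  exact_mod_cast this

theorem isBase_of_card (hr : M.eRank = (r : ℕ∞)) {S : Finset U} (hS : M.Indep (S : Set U))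
    (hcard : S.card = r) : M.IsBase (S : Set U) := by
  obtain ⟨B, hB, hSB⟩ := hS.exists_isBase_superset
  have h : B.encard ≤ (S : Set U).encard := by
    rw [hB.encard_eq_eRank, hr, Set.encard_coe_eq_coe_finsetCard, hcard]
  rwa [(Finset.finite_toSet S).eq_of_subset_of_encard_le hSB h]

theorem exists_indep_insert [DecidableEq U] (hr : M.eRank = (r : ℕ∞)) {S : Finset U}
    (hS : M.Indep (S : Set U)) (hcard : S.card < r) :
    ∃ x, x ∉ S ∧ M.Indep (insert x S : Finset U) := by
  obtain ⟨B, hB⟩ := M.exists_isBase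
  obtain ⟨x, hx, hxS⟩ := hS.augment hB.indep (by
    rw [hB.encard_eq_eRank, hr, Set.encard_coe_eq_coe_finsetCard]
    exact_mod_cast hcard)
  exact ⟨x, fun h => hx.2 h, by simpa using hxS⟩

end Rank

namespace LocalSearch

variable {U : Type u}

/-! ### Accuracy of the estimates -/

theorem nu_apply_toReal {c : ℝ} {A : Finset U} (h : 0 < tau c A) (B : Finset U) :
    (B ⊆ A → (nu c A B).toReal = mcoeff c ((A.card : ℤ) - 1) ((B.card : ℤ) - 1) / tau c A) ∧
      (¬ B ⊆ A → nu c A B = 0) := by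
  unfold nu
  rw [dif_pos h, PMF.ofFinset_apply]
  refine ⟨fun hB => ?_, fun hB => if_neg hB⟩
  rw [if_pos hB, ENNReal.toReal_ofReal (div_nonneg (mcoeff_nonneg _ _ _) h.le)]

theorem subset_of_mem_support_nu {c : ℝ} {A B : Finset U} (hB : B ∈ (nu c A).support) :
    B ⊆ A := by
  by_cases h : 0 < tau c A
  · by_contra hBA
    exact (PMF.mem_support_iff _ _).mp hB ((nu_apply_toReal h B).2 hBA)
  · unfold nu at hB
    rw [dif_neg h, PMF.support_pure, Set.mem_singleton_iff] at hB
    simp [hB]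

theorem sum_nu_mul [Fintype U] {c : ℝ} {A : Finset U} (h : 0 < tau c A) (f : Finset U → ℝ) :
    ∑ B, (nu c A B).toReal * f B = potential c f A / tau c A := by
  rw [← Finset.sum_subset (Finset.subset_univ A.powerset) fun B _ hB => by
    rw [(nu_apply_toReal h B).2 fun h' => hB (Finset.mem_powerset.mpr h')]; simp]
  unfold potential
  rw [Finset.sum_div]
  refine Finset.sum_congr rfl fun B hB => ?_
  rw [(nu_apply_toReal h B).1 (Finset.mem_powerset.mp hB)]
  ring

/-- `y` approximates `g A` up to a relative error of `e`. -/
def IsAccurate (g : Finset U → ℝ) (e : ℝ) (A : Finset U) (y : ℝ) : Prop :=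
  |y - g A| ≤ e * g A

theorem IsAccurate.le {g : Finset U → ℝ} {e y : ℝ} {A : Finset U} (h : IsAccurate g e A y) :
    y ≤ (1 + e) * g A := by
  have := (abs_le.mp h).2
  linarith

theorem IsAccurate.ge {g : Finset U → ℝ} {e y : ℝ} {A : Finset U} (h : IsAccurate g e A y) :
    (1 - e) * g A ≤ y := by
  have := (abs_le.mp h).1
  linarith

/-- The samples range over [0, f(A)] and f(A) ≤ g(A), so the error can be measured relative to g(A).
The uniform bound K on τ makes the failure probability independent of A. -/
theorem failsLE_estimate [Fintype U] [DecidableEq U] {M : Matroid U} {f : Finset U → ℝ} {c : ℝ}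
    (hc : 0 < c) (h0 : IsNormalized f) (hm : Monotone f) (hf : IsSubmodular f) {N : ℕ}
    (hN : 0 < N) {K e : ℝ} (hK : 0 < K) (he : 0 ≤ e) {A : Finset U} (hA : tau c A ≤ K) :
    FailsLE M f (estimate c N A) (IsAccurate (potential c f) e A)
      (ENNReal.ofReal (2 * Real.exp (-2 * N * (e / K) ^ 2))) := by
  classical
  have h00 : f ∅ = 0 := h0
  have hsupp : ∀ B ∈ (nu c A).support, 0 ≤ f B ∧ f B ≤ f A := fun B hB =>
    ⟨h00.symm.le.trans (hm (Finset.empty_subset B)), hm (subset_of_mem_support_nu hB)⟩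
  have hg1 := le_potential hc h0 hm hf A
  have hg2 := potential_le_tau_mul (c := c) hm A
  -- If f(A) = 0, every sample and g(A) vanish and the estimate is exact. This covers A = ∅, and
  -- leaves a positive range for Hoeffding's inequality.
  rcases (h00.symm.le.trans (hm (Finset.empty_subset A))).eq_or_lt with hfA | hfA
  · have hgA : potential c f A = 0 := by
      rw [← hfA, mul_zero] at hg2
      exact le_antisymm hg2 (hfA.le.trans hg1)
    unfold FailsLE estimate
    rw [expect_bind, expect_sampleSum_of_zero fun B hB =>
      le_antisymm ((hsupp B hB).2.trans hfA.symm.le) (hsupp B hB).1]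
    simp [expect, IsAccurate, hgA]
  · have hne : A.Nonempty := by
      rw [Finset.nonempty_iff_ne_empty]
      rintro rfl
      exact hfA.ne' h00
    have hτ := tau_pos hc hne
    have hg : 0 < potential c f A := hfA.trans_le hg1
    have hN' : (0 : ℝ) < N := Nat.cast_pos.mpr hN
    set g := potential c f A with hgdef
    -- The range is enlarged to L = K g/τ, so that with x = e/K the deviation N x L, rescaled by
    -- τ/N, is exactly e g.
    have hL : f A ≤ K * g / tau c A := by
      refine hg1.trans ?_
      rw [le_div_iff₀ hτ, mul_comm]
      gcongr
    have h := failsLE_sampleSum (M := M) (nu c A) (L := K * g / tau c A) (by positivity)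
      (fun B hB => ⟨(hsupp B hB).1, (hsupp B hB).2.trans hL⟩) N (x := e / K) (by positivity)
    rw [sum_nu_mul hτ, ← hgdef] at h
    unfold estimate
    have h' := h.bind (q := fun s => .step (.done (tau c A * (1 / (N : ℝ)) * s)))
      (Q := IsAccurate (potential c f) e A) (δ' := 0) fun s hs => by
        refine FailsLE.step (FailsLE.done ?_ 0)
        unfold IsAccurate
        rw [← hgdef]
        have e1 : tau c A * (1 / (N : ℝ)) * s - g =
            tau c A / N * (s - N * (g / tau c A)) := by
          field_simp
        rw [e1, abs_mul, abs_of_pos (by positivity)]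
        calc _ ≤ tau c A / N * (N * (e / K) * (K * g / tau c A)) := by gcongr
          _ = e * g := by field_simp
    rwa [add_zero] at h'

/-! ### Analysis of the algorithm when the estimates are reliable -/

variable [DecidableEq U] {M : Matroid U} {f g : Finset U → ℝ} {c e : ℝ} {N : ℕ} {δ : ℝ≥0∞}

/-- `best` is an approximately best extension of `S` among the candidates in `D`. -/
def IsBestExtension (M : Matroid U) (g : Finset U → ℝ) (e : ℝ) (S : Finset U) (D : U → Prop)
    (best : Option (U × ℝ)) : Prop :=
  (∀ x₀ y₀, best = some (x₀, y₀) → x₀ ∉ S ∧ M.Indep (insert x₀ S : Finset U) ∧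
    y₀ ≤ (1 + e) * g (insert x₀ S)) ∧
  ∀ x, D x → M.Indep (insert x S : Finset U) →
    ∃ x₀ y₀, best = some (x₀, y₀) ∧ (1 - e) * g (insert x S) ≤ y₀

theorem IsBestExtension.update {S : Finset U} {D : U → Prop} {best : Option (U × ℝ)} {x : U}
    {y : ℝ} (h : IsBestExtension M g e S D best) (hx : x ∉ S)
    (hxS : M.Indep (insert x S : Finset U)) (hy : IsAccurate g e (insert x S) y) :
    IsBestExtension M g e S (fun z => D z ∨ z = x) (if beats y best then some (x, y) else best) := by
  split_ifs with hb
  · refine ⟨?_, ?_⟩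
    · rintro x₀ y₀ ⟨⟩
      exact ⟨hx, hxS, hy.le⟩
    · rintro z (hz | rfl) hzS
      · obtain ⟨x₀, y₀, rfl, hle⟩ := h.2 z hz hzS
        exact ⟨x, y, rfl, hle.trans (of_decide_eq_true hb).le⟩
      · exact ⟨z, y, rfl, hy.ge⟩
  · refine ⟨h.1, ?_⟩
    rintro z (hz | rfl) hzS
    · exact h.2 z hz hzS
    · rcases best with _ | ⟨x₀, y₀⟩
      · exact absurd rfl hb
      · refine ⟨x₀, y₀, rfl, hy.ge.trans ?_⟩
        simpa [beats] using hb

theorem failsLE_bestExtension (hest : ∀ A, FailsLE M f (estimate c N A) (IsAccurate g e A) δ)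
    (S : Finset U) (L : List U) (hL : ∀ x ∈ L, x ∉ S) (D : U → Prop) (best : Option (U × ℝ))
    (h : IsBestExtension M g e S D best) :
    FailsLE M f (bestExtension c N S L best)
      (IsBestExtension M g e S fun z => D z ∨ z ∈ L) (L.length * δ) := by
  induction L generalizing D best with
  | nil => exact .done (by simpa using h) _
  | cons x L ih =>
    have ih' := ih fun z hz => hL z (List.mem_cons_of_mem _ hz)
    rw [bestExtension]
    refine .member (fun hxS => ?_) fun hxS => ?_
    · simp only [if_true]
      refine ((hest _).bind fun y hy => FailsLE.step (ih' _ _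
        (h.update (hL x List.mem_cons_self) hxS hy))).mono (fun out hout => ?_) ?_
      · simpa only [List.mem_cons, or_assoc] using hout
      · rw [List.length_cons]
        push_cast
        rw [add_mul, one_mul, add_comm]
    · simp only [Bool.false_eq_true, if_false]
      refine (ih' _ best h).mono (fun out hout => ⟨hout.1, fun z hz hzS => ?_⟩) ?_
      · refine hout.2 z ?_ hzS
        rcases hz with hz | hz
        · exact Or.inl hz
        · rcases List.mem_cons.mp hz with rfl | hz
          · exact absurd hzS hxS
          · exact Or.inr hz
      · gcongr
        simp

omit [DecidableEq U] in
theorem length_elems_le [Fintype U] (ord : ScanOrder U) (S : Finset U) :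
    (ord.elems S).length ≤ Fintype.card U :=
  (ord.elems_nodup S).length_le_card

theorem length_pairs_le [Fintype U] (ord : ScanOrder U) (S : Finset U) :
    (ord.pairs S).length ≤ S.card * Fintype.card U := by
  rw [← List.toFinset_card_of_nodup (ord.pairs_nodup S), ← Finset.card_univ,
    ← Finset.card_product]
  refine Finset.card_le_card fun p hp => ?_
  rw [List.mem_toFinset, ord.mem_pairs] at hp
  simp [hp.1]

/-- Each round makes at most n estimates. An independent set smaller than r always has an extension,
so with accurate estimates the early stop never occurs. -/
theorem failsLE_greedy [Fintype U] {r : ℕ} (hr : M.eRank = (r : ℕ∞)) (ord : ScanOrder U)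
    (hest : ∀ A, FailsLE M f (estimate c N A) (IsAccurate g e A) δ) (k : ℕ) (S : Finset U)
    (hS : ApproxGreedy M g e S) (hk : S.card + k = r) :
    FailsLE M f (greedy ord c N k S) (fun S' => ApproxGreedy M g e S' ∧ M.IsBase (S' : Set U))
      (k * (Fintype.card U * δ)) := by
  induction k generalizing S with
  | zero => exact .done ⟨hS, isBase_of_card hr hS.indep hk⟩ _
  | succ k ih =>
    rw [greedy]
    have hbest := failsLE_bestExtension hest S (ord.elems S)
      (fun x hx => (ord.mem_elems S x).mp hx) (fun _ => False) none
      ⟨fun _ _ h => by simp at h, fun _ h => h.elim⟩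
    refine (hbest.bind (δ' := k * (Fintype.card U * δ)) ?_).mono (fun _ h => h) ?_
    · rintro (_ | ⟨x, y⟩) hout
      · obtain ⟨z, hz, hzS⟩ := exists_indep_insert hr hS.indep (by omega)
        obtain ⟨_, _, h, _⟩ := hout.2 z (Or.inr ((ord.mem_elems S z).mpr hz)) hzS
        simp at h
      · obtain ⟨hx, hxS, hy⟩ := hout.1 x y rfl
        refine FailsLE.step (ih _ (.cons hS hx hxS fun z hz hzS => ?_) ?_)
        · obtain ⟨x₀, y₀, h, hle⟩ := hout.2 z (Or.inr ((ord.mem_elems S z).mpr hz)) hzS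
          simp only [Option.some.injEq, Prod.mk.injEq] at h
          obtain ⟨rfl, rfl⟩ := h
          exact hle.trans hy
        · rw [Finset.card_insert_of_notMem hx]
          omega
    · push_cast
      rw [add_mul, one_mul, add_comm]
      gcongr
      exact length_elems_le ord S

/-- The outcome of an iteration of the local search from `S`, when all estimates are accurate. -/
def IsSwapResult (M : Matroid U) (g : Finset U → ℝ) (e : ℝ) (S : Finset U) (v : ℝ)
    (D : U × U → Prop) : Option (Finset U × ℝ) → Prop
  | none => ∀ p, D p → M.Indep (insert p.2 (S.erase p.1) : Finset U) →
      (1 - e) * g (insert p.2 (S.erase p.1)) ≤ (1 + e) * v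
  | some (S', v') => M.Indep (S' : Set U) ∧ S'.card = S.card ∧ IsAccurate g e S' v' ∧
      (1 + e) * v < v'

theorem card_swap {S : Finset U} {a x : U} (ha : a ∈ S) (hx : x ∉ S) :
    (insert x (S.erase a)).card = S.card := by
  rw [Finset.card_insert_of_notMem fun h => hx (Finset.mem_of_mem_erase h),
    Finset.card_erase_add_one ha]

theorem failsLE_findSwap (hest : ∀ A, FailsLE M f (estimate c N A) (IsAccurate g e A) δ)
    (S : Finset U) (v : ℝ) (L : List (U × U)) (hL : ∀ p ∈ L, p.1 ∈ S ∧ p.2 ∉ S) :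
    FailsLE M f (findSwap c N e S v L) (IsSwapResult M g e S v (· ∈ L)) (L.length * δ) := by
  induction L with
  | nil => exact .done (fun p hp => by simp at hp) _
  | cons p L ih =>
    obtain ⟨a, x⟩ := p
    have ih' := ih fun z hz => hL z (List.mem_cons_of_mem _ hz)
    have hax := hL (a, x) List.mem_cons_self
    rw [findSwap]
    refine .step (.member (fun hS' => ?_) fun hS' => ?_)
    · simp only [if_true]
      refine ((hest _).bind (Q := IsSwapResult M g e S v (· ∈ (a, x) :: L))
        (δ' := L.length * δ) fun y hy => FailsLE.step ?_).mono (fun _ h => h) ?_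
      · split_ifs with hlt
        · exact .done ⟨hS', card_swap hax.1 hax.2, hy, hlt⟩ _
        · refine ih'.mono (fun out hout => ?_) le_rfl
          rcases out with _ | ⟨S', v'⟩
          · intro q hq hqS
            rcases List.mem_cons.mp hq with rfl | hq
            · exact hy.ge.trans (not_lt.mp hlt)
            · exact hout q hq hqS
          · exact hout
      · rw [List.length_cons]
        push_cast
        rw [add_mul, one_mul, add_comm]
    · simp only [Bool.false_eq_true, if_false]
      refine ih'.mono (fun out hout => ?_) (by gcongr; simp)
      rcases out with _ | ⟨S', v'⟩
      · intro q hq hqS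
        rcases List.mem_cons.mp hq with rfl | hq
        · exact absurd hqS hS'
        · exact hout q hq hqS
      · exact hout

/-- `S` is a base which is locally optimal for `g` up to the errors of the estimates. -/
def IsLocalOptimum (M : Matroid U) (g : Finset U → ℝ) (e : ℝ) (S : Finset U) : Prop :=
  M.IsBase (S : Set U) ∧ ∀ a ∈ S, ∀ x, x ∉ S → M.Indep (insert x (S.erase a) : Finset U) →
    (1 - e) * g (insert x (S.erase a)) ≤ (1 + e) ^ 2 * g S

/-- The invariant is (1 + e) G ≤ (1 + e)^k v with k iterations left: a swap multiplies v by more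
than 1 + e, so it survives, now strictly. At k = 0 the strict form contradicts v ≤ (1 + e) g(S) ≤ (1
+ e) G, so the error is never reached. Strictness is a separate hypothesis because it may be absent
before the first swap. -/
theorem failsLE_localSearch [Fintype U] {r : ℕ} (hr : M.eRank = (r : ℕ∞)) (ord : ScanOrder U)
    (hest : ∀ A, FailsLE M f (estimate c N A) (IsAccurate g e A) δ) (he : 0 ≤ e) {G : ℝ}
    (hG : ∀ S : Finset U, M.IsBase (S : Set U) → g S ≤ G) (k : ℕ) (S : Finset U) (v : ℝ)
    (hS : M.IsBase (S : Set U)) (hv : IsAccurate g e S v)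
    (hvk : (1 + e) * G ≤ (1 + e) ^ k * v) (hv0 : k = 0 → (1 + e) * G < v) :
    FailsLE M f (localSearch ord c N e k S v)
      (fun out => ∃ S', out = some S' ∧ IsLocalOptimum M g e S')
      (k * ((r * Fintype.card U : ℕ) * δ)) := by
  induction k generalizing S v with
  | zero =>
    have h1 := hv0 rfl
    have h2 := mul_le_mul_of_nonneg_left (hG S hS) (show 0 ≤ 1 + e by linarith)
    exact absurd (h1.trans_le (hv.le.trans h2)) (lt_irrefl _)
  | succ k ih =>
    rw [localSearch]
    have hswap := failsLE_findSwap hest S v (ord.pairs S) fun p hp => (ord.mem_pairs S p).mp hp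
    refine (hswap.bind (δ' := k * ((r * Fintype.card U : ℕ) * δ)) ?_).mono (fun _ h => h) ?_
    · rintro (_ | ⟨S', v'⟩) hout
      · refine .done ⟨S, rfl, hS, fun a ha x hx hax => ?_⟩ _
        refine (hout (a, x) ((ord.mem_pairs S _).mpr ⟨ha, hx⟩) hax).trans ?_
        rw [pow_two, mul_assoc]
        exact mul_le_mul_of_nonneg_left hv.le (by linarith)
      · obtain ⟨hS', hcard, hv', hlt⟩ := hout
        have hlt' : (1 + e) * G < (1 + e) ^ k * v' := by
          refine hvk.trans_lt ?_
          rw [pow_succ, mul_assoc]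
          exact mul_lt_mul_of_pos_left hlt (by positivity)
        refine FailsLE.step (ih S' v' (isBase_of_card hr hS' (hcard.trans (isBase_card hr hS)))
          hv' hlt'.le ?_)
        rintro rfl
        simpa using hlt'
    · have := length_pairs_le ord S
      rw [isBase_card hr hS] at this
      push_cast
      rw [add_mul, one_mul, add_comm]
      gcongr
      exact_mod_cast this

/-! ### Running time -/

omit [DecidableEq U] in
theorem haltsWithin_sampleSum (μ : PMF (Finset U)) (k : ℕ) (acc : ℝ) :
    HaltsWithin (fun _ => True) (3 * k) (sampleSum μ k acc) := by
  induction k generalizing acc with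
  | zero => exact .done _ trivial
  | succ k ih => exact .sample fun B => .value fun y => .step (ih _)

omit [DecidableEq U] in
theorem haltsWithin_estimate (c : ℝ) (N : ℕ) (A : Finset U) :
    HaltsWithin (fun _ => True) (3 * N + 1) (estimate c N A) :=
  (haltsWithin_sampleSum _ _ _).bind fun _ _ => .step (.done _ trivial)

/-- Per candidate: one membership query, 3N + 1 steps for the estimate and one comparison. In
`findSwap` each pair costs one step more. -/
theorem haltsWithin_bestExtension (c : ℝ) (N : ℕ) (S : Finset U) (L : List U)
    (best : Option (U × ℝ)) :
    HaltsWithin (fun _ => True) (L.length * (3 * N + 3)) (bestExtension c N S L best) := by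
  induction L generalizing best with
  | nil => exact .done _ trivial
  | cons x L ih =>
    rw [bestExtension]
    refine (HaltsWithin.member (T := 3 * N + 1 + (L.length * (3 * N + 3) + 1)) ?_).mono
      (by rw [List.length_cons]; linarith)
    rintro (_ | _)
    · simp only [Bool.false_eq_true, if_false]
      exact (ih _).mono (by omega)
    · simp only [if_true]
      exact (haltsWithin_estimate _ _ _).bind fun _ _ => .step (ih _)

theorem haltsWithin_greedy [Fintype U] (ord : ScanOrder U) (c : ℝ) (N k : ℕ) (S : Finset U)
    {r : ℕ} (hr : S.card + k ≤ r) :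
    HaltsWithin (fun S' => S'.card ≤ r) (k * (Fintype.card U * (3 * N + 3) + 1))
      (greedy ord c N k S) := by
  induction k generalizing S with
  | zero => exact .done _ hr
  | succ k ih =>
    rw [greedy]
    refine HaltsWithin.mono (((haltsWithin_bestExtension c N S (ord.elems S) none).mono
      (Nat.mul_le_mul_right _ (length_elems_le ord S))).bind
      (T' := k * (Fintype.card U * (3 * N + 3) + 1) + 1) ?_) (by linarith)
    rintro (_ | ⟨x, y⟩) _
    · exact .done _ (by omega)
    · have := Finset.card_insert_le x S
      exact .step (ih _ (by omega))

/-- The size bound in the postcondition keeps the next list of pairs at length at most r n. It must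
hold for arbitrary oracle answers, so it comes from the form of the swap and not from independence.
-/
theorem haltsWithin_findSwap (c : ℝ) (N : ℕ) (e : ℝ) (S : Finset U) (v : ℝ) (L : List (U × U))
    (hL : ∀ p ∈ L, p.1 ∈ S) :
    HaltsWithin (fun res => ∀ S' v', res = some (S', v') → S'.card ≤ S.card)
      (L.length * (3 * N + 4)) (findSwap c N e S v L) := by
  induction L with
  | nil => exact .done _ fun _ _ h => by simp at h
  | cons p L ih =>
    obtain ⟨a, x⟩ := p
    have ih' := ih fun z hz => hL z (List.mem_cons_of_mem _ hz)
    have ha : a ∈ S := hL (a, x) List.mem_cons_self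
    rw [findSwap]
    refine (HaltsWithin.step (HaltsWithin.member
      (T := 3 * N + 1 + (L.length * (3 * N + 4) + 1)) ?_)).mono
      (by rw [List.length_cons]; linarith)
    rintro (_ | _)
    · simp only [Bool.false_eq_true, if_false]
      exact ih'.mono (by omega)
    · simp only [if_true]
      refine (haltsWithin_estimate _ _ _).bind fun y _ => .step ?_
      split_ifs
      · refine .done _ fun S' v' h => ?_
        simp only [Option.some.injEq, Prod.mk.injEq] at h
        rw [← h.1]
        refine (Finset.card_insert_le _ _).trans ?_
        rw [Finset.card_erase_add_one ha]
      · exact ih'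

theorem haltsWithin_localSearch [Fintype U] (ord : ScanOrder U) (c : ℝ) (N : ℕ) (e : ℝ) {r : ℕ}
    (k : ℕ) (S : Finset U) (v : ℝ) (hS : S.card ≤ r) :
    HaltsWithin (fun _ => True) (k * (r * Fintype.card U * (3 * N + 4) + 1))
      (localSearch ord c N e k S v) := by
  induction k generalizing S v with
  | zero => exact .done _ trivial
  | succ k ih =>
    rw [localSearch]
    refine HaltsWithin.mono (((haltsWithin_findSwap c N e S v (ord.pairs S)
      fun p hp => ((ord.mem_pairs S p).mp hp).1).mono (Nat.mul_le_mul_right _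
        ((length_pairs_le ord S).trans (Nat.mul_le_mul_right _ hS)))).bind
      (T' := k * (r * Fintype.card U * (3 * N + 4) + 1) + 1) ?_) (by linarith)
    rintro (_ | ⟨S', v'⟩) h
    · exact .done _ trivial
    · exact .step (ih _ _ ((h S' v' rfl).trans hS))

end LocalSearch

/-! ### Total step count and the constants attached to c. -/

open LocalSearch

theorem haltsWithin_nonObliviousLocalSearch {U : Type u} [Fintype U] [DecidableEq U]
    (ord : ScanOrder U) (r : ℕ) (c ε α : ℝ) {N : ℕ}
    (hN : numSamples (Fintype.card U) r c ε α = N) :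
    HaltsWithin (fun _ => True) (r * (Fintype.card U * (3 * N + 3) + 1) + (3 * N + 1 +
      numIter r ε * (r * Fintype.card U * (3 * N + 4) + 1)))
      (nonObliviousLocalSearch ord r c ε α) := by
  unfold nonObliviousLocalSearch
  rw [hN]
  exact (haltsWithin_greedy ord c N r ∅ (by simp)).bind fun S hS => (haltsWithin_estimate _ _ _).bind
    fun v _ => haltsWithin_localSearch ord c N _ _ S v hS

theorem rho_mul_density_one {c : ℝ} (hc : 0 < c) : rho c * density c 1 = 1 := by
  have h := (exp_sub_one_pos hc).ne'
  unfold rho density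
  rw [Real.exp_neg, mul_one]
  field_simp

theorem rho_nonneg {c : ℝ} (hc : 0 < c) : 0 ≤ rho c :=
  div_nonneg (sub_nonneg.mpr (Real.exp_le_one_iff.mpr (by linarith))) hc.le

theorem rho_le_one {c : ℝ} (hc : 0 < c) : rho c ≤ 1 := by
  unfold rho
  rw [div_le_one hc]
  linarith [Real.add_one_le_exp (-c)]

theorem density_one_le {c : ℝ} (hc : 0 < c) (hc1 : c ≤ 1) : density c 1 ≤ 3 := by
  unfold density
  rw [mul_one, div_le_iff₀ (exp_sub_one_pos hc)]
  have h1 := Real.add_one_le_exp c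
  have h2 : Real.exp c ≤ 3 := (Real.exp_le_exp.mpr hc1).trans (by
    linarith [Real.exp_one_lt_d9])
  nlinarith [Real.exp_pos c]

/-! ### Numerical bounds on ε₂ and on the number of iterations. -/

section Parameters

variable {r : ℕ} {ε : ℝ}

theorem three_halves_le_harmonic (hr : 2 ≤ r) : (3 / 2 : ℝ) ≤ harmonic r := by
  refine le_trans ?_ (harmonic_cast_mono hr)
  norm_num [harmonic, Finset.sum_range_succ]

theorem four_mul_epsTwo (hr : 2 ≤ r) : 4 * r * (harmonic r : ℝ) * epsTwo r ε = ε := by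
  have h1 := three_halves_le_harmonic hr
  have h2 : (2 : ℝ) ≤ r := by exact_mod_cast hr
  unfold epsTwo
  field_simp

theorem epsTwo_pos (hr : 2 ≤ r) (hε : 0 < ε) : 0 < epsTwo r ε := by
  have h1 := three_halves_le_harmonic hr
  have h2 : (2 : ℝ) ≤ r := by exact_mod_cast hr
  unfold epsTwo
  positivity

theorem epsTwo_le (hr : 2 ≤ r) (hε1 : ε ≤ 1) : epsTwo r ε ≤ 1 / 12 := by
  have h1 := three_halves_le_harmonic hr
  have h2 : (2 : ℝ) ≤ r := by exact_mod_cast hr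
  unfold epsTwo
  rw [div_le_iff₀ (by positivity)]
  nlinarith

theorem mul_epsTwo_le (hr : 2 ≤ r) (hε1 : ε ≤ 1) : 3 * r * epsTwo r ε ≤ 1 / 2 := by
  have h1 := three_halves_le_harmonic hr
  have h2 : (2 : ℝ) ≤ r := by exact_mod_cast hr
  have e : 3 * r * epsTwo r ε = 3 * ε / (4 * harmonic r) := by
    unfold epsTwo
    field_simp
  rw [e, div_le_iff₀ (by positivity)]
  linarith

theorem one_add_numIter_le (hr : 2 ≤ r) (hε : 0 < ε) (hε1 : ε ≤ 1) :
    (numIter r ε : ℝ) + 1 ≤ 16 * r * harmonic r / ε := by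
  have h0 := epsTwo_pos hr hε
  have h1 := epsTwo_le hr hε1
  have h2 := mul_epsTwo_le hr hε1
  have h3 := three_halves_le_harmonic hr
  have h4 : (2 : ℝ) ≤ r := by exact_mod_cast hr
  have h5 := four_mul_epsTwo (ε := ε) hr
  set e := epsTwo r ε with he
  -- With 3 r e ≤ 1/2 this needs e ≤ 1/11, and e ≤ 1/12 is available. Then I ≤ 2/e + 1, so I + 1 ≤
  -- 4/e.
  have hK : (1 + e) / (1 - e) * (2 + 3 * r * e) ≤ 3 := by
    rw [div_mul_eq_mul_div, div_le_iff₀ (by linarith)]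
    nlinarith
  have hnn : 0 ≤ ((1 + e) / (1 - e) * (2 + 3 * r * e) - 1) / e := by
    refine div_nonneg (sub_nonneg.mpr ?_) h0.le
    rw [div_mul_eq_mul_div, le_div_iff₀ (by linarith)]
    have : 0 ≤ 3 * r * e := by positivity
    nlinarith
  have hI := (Nat.ceil_lt_add_one hnn).le
  have hI' : (numIter r ε : ℝ) ≤ ((1 + e) / (1 - e) * (2 + 3 * r * e) - 1) / e + 1 := hI
  have e1 : 16 * r * (harmonic r : ℝ) / ε = 4 / e := by
    rw [div_eq_div_iff hε.ne' h0.ne']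
    linarith
  have e2 : ((1 + e) / (1 - e) * (2 + 3 * r * e) - 1) / e ≤ 2 / e := by
    gcongr
    linarith
  have e3 : 1 ≤ 1 / e := by
    rw [le_div_iff₀ h0]
    linarith
  have e4 : 4 / e = 2 / e + 1 / e + 1 / e := by ring
  rw [e1]
  linarith

/-- Bernoulli's inequality: (1 + e)^I ≥ 1 + I e, and I was chosen to make this at least the required
factor. Positivity of I discharges the k = 0 hypothesis of `failsLE_localSearch`. -/
theorem le_one_add_epsTwo_pow_numIter (hr : 2 ≤ r) (hε : 0 < ε) (hε1 : ε ≤ 1) :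
    0 < numIter r ε ∧ (1 + epsTwo r ε) / (1 - epsTwo r ε) * (2 + 3 * r * epsTwo r ε) ≤
      (1 + epsTwo r ε) ^ numIter r ε := by
  have h0 := epsTwo_pos hr hε
  have h1 := epsTwo_le hr hε1
  set e := epsTwo r ε with he
  have hK : 1 < (1 + e) / (1 - e) * (2 + 3 * r * e) := by
    rw [div_mul_eq_mul_div, lt_div_iff₀ (by linarith)]
    have : 0 ≤ 3 * r * e := by positivity
    nlinarith
  refine ⟨Nat.ceil_pos.mpr (div_pos (sub_pos.mpr hK) h0), ?_⟩
  have hI : ((1 + e) / (1 - e) * (2 + 3 * r * e) - 1) / e ≤ numIter r ε := Nat.le_ceil _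
  rw [div_le_iff₀ h0] at hI
  have := one_add_mul_le_pow (show (-2 : ℝ) ≤ e by linarith) (numIter r ε)
  linarith

end Parameters

/-! ### Quality of local optima and failure probability of the whole algorithm. -/

section Approximation

variable {U : Type u} [Fintype U] [DecidableEq U] {M : Matroid U} {f : Finset U → ℝ} {r : ℕ}
  {c ε α : ℝ}

/-- Approximate local optima of the potential are approximate maximizers of the objective. -/
theorem LocalSearch.IsLocalOptimum.isApproxSolution (hr : M.eRank = (r : ℕ∞)) (hr2 : 2 ≤ r)
    (h0 : IsNormalized f) (hm : Monotone f) (hf : IsSubmodular f) (hc : 0 < c) (hc1 : c ≤ 1)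
    (hcurv : HasCurvature f c) (hε : 0 < ε) (hε1 : ε ≤ 1) {S : Finset U}
    (hS : IsLocalOptimum M (potential c f) (epsTwo r ε) S) :
    IsApproxSolution M f (rho c - ε) (some S) := by
  refine ⟨S, rfl, hS.1.indep, fun O hO => ?_⟩
  have h00 : f ∅ = 0 := h0
  have hf0 : ∀ A, 0 ≤ f A := fun A => h00.symm.le.trans (hm (Finset.empty_subset A))
  obtain ⟨B, hB, hOB⟩ := hO.exists_isBase_superset
  lift B to Finset U using B.toFinite
  have hfOB : f O ≤ f B := hm (by exact_mod_cast hOB)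
  obtain ⟨s, hinj, himg, hs, hind⟩ := exists_swap_bijection hS.1 hB
  have hswap := sum_potential_swap_le hf hm h0 hcurv hc hc1 s hinj hs
  rw [himg] at hswap
  have e0 := epsTwo_pos hr2 hε
  have e1 := epsTwo_le hr2 hε1
  have e2 := four_mul_epsTwo (ε := ε) hr2
  set e := epsTwo r ε with he
  set g := potential c f with hg
  have hgS : 0 ≤ g S := potential_nonneg h0 hm S
  -- Local optimality gives the factor (1 + e)²/(1 - e), which is at most 1 + 4e because e ≤ 1/5.
  -- Fixed points of s are trivial swaps.
  have hterm : ∀ a ∈ S, -(4 * e * g S) ≤ g S - g (insert (s a) (S.erase a)) := by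
    intro a ha
    rcases hs a ha with h | h
    · have h1 := hS.2 a ha (s a) h (hind a ha)
      have h2 : (1 + e) ^ 2 ≤ (1 - e) * (1 + 4 * e) := by nlinarith
      have h3 := h1.trans (mul_le_mul_of_nonneg_right h2 hgS)
      rw [mul_assoc] at h3
      have := le_of_mul_le_mul_left h3 (by linarith)
      linarith
    · rw [h, Finset.insert_erase ha, sub_self, neg_nonpos]
      positivity
  have hsum := Finset.card_nsmul_le_sum S _ _ hterm
  rw [nsmul_eq_mul, isBase_card hr hS.1] at hsum
  have hκ := density_one_pos hc
  have hgle : g S ≤ density c 1 * harmonic r * f S := by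
    refine (potential_le_tau_mul hm S).trans (mul_le_mul_of_nonneg_right ?_ (hf0 S))
    have := tau_le hc S
    rwa [isBase_card hr hS.1] at this
  have h1 : f B ≤ density c 1 * ((1 + ε) * f S) := by
    have h2 := mul_le_mul_of_nonneg_left hgle (show (0 : ℝ) ≤ r * (4 * e) by positivity)
    have h3 : (r * (4 * e)) * (density c 1 * harmonic r * f S) = density c 1 * ε * f S := by
      rw [← e2]
      ring
    linarith
  have hρ := rho_nonneg hc
  have hρ1 := rho_le_one hc
  have h2 : rho c * f B ≤ (1 + ε) * f S := by
    have := mul_le_mul_of_nonneg_left h1 hρ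
    rwa [← mul_assoc, rho_mul_density_one hc, one_mul] at this
  -- It remains to pass from ρ f(B) ≤ (1 + ε) f(S) to an additive loss. A nonpositive ratio is
  -- trivial; if f(S) ≤ f(B), then ε f(S) ≤ ε f(B); otherwise ρ ≤ 1 suffices.
  rcases le_total (rho c) ε with h | h
  · exact (mul_nonpos_of_nonpos_of_nonneg (sub_nonpos.mpr h) (hf0 O)).trans (hf0 S)
  · refine (mul_le_mul_of_nonneg_left hfOB (sub_nonneg.mpr h)).trans ?_
    rcases le_total (f S) (f B) with h' | h'
    · nlinarith
    · nlinarith [hf0 B]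

theorem failsLE_nonObliviousLocalSearch (hr : M.eRank = (r : ℕ∞)) (hr2 : 2 ≤ r)
    (h0 : IsNormalized f) (hm : Monotone f) (hf : IsSubmodular f) (hc : 0 < c) (hc1 : c ≤ 1)
    (hcurv : HasCurvature f c) (hε : 0 < ε) (hε1 : ε ≤ 1) (ord : ScanOrder U) {N : ℕ}
    (hN : numSamples (Fintype.card U) r c ε α = N) {δ : ℝ≥0∞}
    (hest : ∀ A, FailsLE M f (estimate c N A) (IsAccurate (potential c f) (epsTwo r ε) A) δ) :
    FailsLE M f (nonObliviousLocalSearch ord r c ε α) (IsApproxSolution M f (rho c - ε))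
      (r * (Fintype.card U * δ) + (δ + numIter r ε * ((r * Fintype.card U : ℕ) * δ))) := by
  have e0 := epsTwo_pos hr2 hε
  have e1 := epsTwo_le hr2 hε1
  obtain ⟨hI, hpow⟩ := le_one_add_epsTwo_pow_numIter hr2 hε hε1
  unfold nonObliviousLocalSearch
  rw [hN]
  set e := epsTwo r ε with he
  set g := potential c f with hg
  refine (failsLE_greedy hr ord hest r ∅ .nil (by simp)).bind fun S hS => (hest S).bind fun v hv =>
    (failsLE_localSearch hr ord hest e0.le (G := (2 + 3 * r * e) * g S)
      (fun O hO => ?_) _ S v hS.2 hv ?_ (fun h => absurd h hI.ne')).mono ?_ le_rfl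
  · have := hS.1.le_mul e0.le (by linarith) (potential_mono h0 hm) (potential_empty h0)
      (fun A B h x => potential_insert_sub_le h0 hm hf h x) hS.2 hO
    rwa [isBase_card hr hS.2] at this
  -- The factor (1 + e)/(1 - e) in I pays for starting from an estimate: v ≥ (1 - e) g(S), while the
  -- target is (1 + e) G.
  · have hv0 : 0 ≤ v := le_trans
      (mul_nonneg (by linarith) (potential_nonneg h0 hm S)) hv.ge
    refine le_trans ?_ (mul_le_mul_of_nonneg_right hpow hv0)
    have h1 := mul_le_mul_of_nonneg_left hv.ge
      (show 0 ≤ (1 + e) / (1 - e) * (2 + 3 * r * e) from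
        mul_nonneg (div_nonneg (by linarith) (by linarith)) (by positivity))
    refine le_trans (le_of_eq ?_) h1
    have : (1 - e) ≠ 0 := by linarith
    field_simp
  · rintro _ ⟨S', rfl, hS'⟩
    exact hS'.isApproxSolution hr hr2 h0 hm hf hc hc1 hcurv hε hε1

end Approximation

/-- The argument of the logarithm in the number of samples. -/
noncomputable def sampleArg (n r : ℕ) (ε α : ℝ) : ℝ :=
  ((numIter r ε : ℝ) + 1) * r * (n : ℝ) ^ (1 + α)

/-! ### Number of samples, union bound and total running time. -/

section Bounds

variable {n r : ℕ} {c ε α : ℝ}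

theorem two_le_sampleArg (hr : 2 ≤ r) (hn : r ≤ n) (hα : 0 < α) : 2 ≤ sampleArg n r ε α := by
  unfold sampleArg
  have h1 : (2 : ℝ) ≤ r := by exact_mod_cast hr
  have h2 : (1 : ℝ) ≤ n := by exact_mod_cast (by omega : 1 ≤ n)
  have h3 : 1 ≤ (n : ℝ) ^ (1 + α) := Real.one_le_rpow h2 (by linarith)
  have h4 : (1 : ℝ) ≤ (numIter r ε : ℝ) + 1 := by linarith [Nat.cast_nonneg (α := ℝ) (numIter r ε)]
  have h5 : (2 : ℝ) ≤ ((numIter r ε : ℝ) + 1) * r := by nlinarith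
  nlinarith

theorem numSamples_eq : numSamples n r c ε α =
    ⌈1 / 2 * (density c 1 * ((harmonic n : ℝ) / epsTwo r ε)) ^ 2 *
      Real.log (sampleArg n r ε α)⌉₊ := by
  unfold numSamples density sampleArg
  rw [mul_one]

theorem harmonic_pos_of_two_le (hn : 2 ≤ n) : (0 : ℝ) < harmonic n :=
  lt_of_lt_of_le (by norm_num) (three_halves_le_harmonic hn)

theorem numSamples_pos (hr : 2 ≤ r) (hn : r ≤ n) (hc : 0 < c) (hε : 0 < ε) (hα : 0 < α) :
    0 < numSamples n r c ε α := by
  rw [numSamples_eq, Nat.ceil_pos]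
  have h1 := Real.log_pos (lt_of_lt_of_le one_lt_two (two_le_sampleArg (ε := ε) hr hn hα))
  have h2 := density_one_pos hc
  have h3 := epsTwo_pos hr hε
  have h4 := harmonic_pos_of_two_le (hr.trans hn)
  positivity

/-- The failure probability of a single estimate. -/
theorem exp_numSamples_le (hr : 2 ≤ r) (hn : r ≤ n) (hc : 0 < c) (hε : 0 < ε) (hα : 0 < α) :
    Real.exp (-2 * numSamples n r c ε α * (epsTwo r ε / (density c 1 * harmonic n)) ^ 2) ≤
      (sampleArg n r ε α)⁻¹ := by
  have h0 := two_le_sampleArg (ε := ε) hr hn hα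
  have h2 := density_one_pos hc
  have h3 := epsTwo_pos hr hε
  have h4 := harmonic_pos_of_two_le (hr.trans hn)
  rw [← Real.exp_log (show 0 < (sampleArg n r ε α)⁻¹ by positivity), Real.exp_le_exp, Real.log_inv]
  have h5 : 1 / 2 * (density c 1 * ((harmonic n : ℝ) / epsTwo r ε)) ^ 2 *
      Real.log (sampleArg n r ε α) ≤ numSamples n r c ε α := by
    rw [numSamples_eq]
    exact Nat.le_ceil _
  have h6 := mul_le_mul_of_nonneg_right h5
    (show 0 ≤ 2 * (epsTwo r ε / (density c 1 * harmonic n)) ^ 2 by positivity)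
  have h7 : 1 / 2 * (density c 1 * ((harmonic n : ℝ) / epsTwo r ε)) ^ 2 *
      Real.log (sampleArg n r ε α) * (2 * (epsTwo r ε / (density c 1 * harmonic n)) ^ 2) =
      Real.log (sampleArg n r ε α) := by
    field_simp
  linarith

/-- The union bound over all estimates. -/
theorem total_failure_le (hr : 2 ≤ r) (hn : r ≤ n) :
    (r * (n * (2 * (sampleArg n r ε α)⁻¹)) + (2 * (sampleArg n r ε α)⁻¹ +
      numIter r ε * (((r * n : ℕ) : ℝ) * (2 * (sampleArg n r ε α)⁻¹)))) ≤ 4 * (n : ℝ) ^ (-α) := by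
  have h1 : (2 : ℝ) ≤ r := by exact_mod_cast hr
  have h2 : (2 : ℝ) ≤ n := by exact_mod_cast (hr.trans hn)
  have hI := Nat.cast_nonneg (α := ℝ) (numIter r ε)
  have hX : sampleArg n r ε α = ((numIter r ε : ℝ) + 1) * r * n * (n : ℝ) ^ α := by
    unfold sampleArg
    rw [Real.rpow_add (by linarith), Real.rpow_one]
    ring
  have hp : 0 < (n : ℝ) ^ α := Real.rpow_pos_of_pos (by linarith) _
  rw [Real.rpow_neg (by linarith), hX]
  set I := (numIter r ε : ℝ)
  have hD : 1 ≤ (I + 1) * r * n := by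
    have : 2 ≤ (I + 1) * r := by nlinarith
    nlinarith
  -- The (I + 1) r n estimates of the two phases cancel against the sample argument; the single
  -- estimate between them gives the additional term, at most 2 n^{-α}.
  have e : (r * (n * (2 * ((I + 1) * r * n * (n : ℝ) ^ α)⁻¹)) +
      (2 * ((I + 1) * r * n * (n : ℝ) ^ α)⁻¹ +
      I * (((r * n : ℕ) : ℝ) * (2 * ((I + 1) * r * n * (n : ℝ) ^ α)⁻¹)))) =
      (2 + 2 * ((I + 1) * r * n)⁻¹) * ((n : ℝ) ^ α)⁻¹ := by
    push_cast
    field_simp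
    ring
  rw [e]
  gcongr
  have := inv_le_one_of_one_le₀ hD
  linarith

theorem half_le_log_div (hn : 2 ≤ n) (hε : 0 < ε) (hε1 : ε ≤ 1) :
    1 / 2 ≤ Real.log (n / ε) ∧ (2 : ℝ) ≤ n / ε := by
  have h2 : (2 : ℝ) ≤ n := by exact_mod_cast hn
  have h : (2 : ℝ) ≤ n / ε := by
    rw [le_div_iff₀ hε]
    nlinarith
  refine ⟨?_, h⟩
  have := Real.log_le_log (by norm_num) h
  linarith [Real.log_two_gt_d9]

theorem log_natCast_le (hr : 1 ≤ r) (hn : r ≤ n) (hε : 0 < ε) (hε1 : ε ≤ 1) :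
    Real.log r ≤ Real.log (n / ε) := by
  have h1 : (1 : ℝ) ≤ r := by exact_mod_cast hr
  have h2 : (r : ℝ) ≤ n := by exact_mod_cast hn
  refine Real.log_le_log (by linarith) ?_
  rw [le_div_iff₀ hε]
  nlinarith

theorem harmonic_le_log (hr : 2 ≤ r) (hn : r ≤ n) (hε : 0 < ε) (hε1 : ε ≤ 1) :
    (harmonic r : ℝ) ≤ 3 * Real.log (n / ε) := by
  have h1 := harmonic_le_one_add_log r
  have h2 := log_natCast_le (by omega) hn hε hε1
  have h3 := (half_le_log_div (hr.trans hn) hε hε1).1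
  linarith

theorem harmonic_cast_le (r : ℕ) : (harmonic r : ℝ) ≤ r := by
  induction r with
  | zero => simp
  | succ r ih =>
    rw [harmonic_succ]
    push_cast
    have : ((r : ℝ) + 1)⁻¹ ≤ 1 := inv_le_one_of_one_le₀ (by linarith [Nat.cast_nonneg (α := ℝ) r])
    linarith

theorem log_sampleArg_le (hr : 2 ≤ r) (hn : r ≤ n) (hε : 0 < ε) (hε1 : ε ≤ 1) (hα : 0 < α) :
    Real.log (sampleArg n r ε α) ≤ 9 * max 1 α * Real.log (n / ε) := by
  have h1 : (2 : ℝ) ≤ r := by exact_mod_cast hr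
  have h2 : (r : ℝ) ≤ n := by exact_mod_cast hn
  have hI := Nat.cast_nonneg (α := ℝ) (numIter r ε)
  obtain ⟨hl, hq⟩ := half_le_log_div (hr.trans hn) hε hε1
  have hnq : (n : ℝ) ≤ n / ε := by
    rw [le_div_iff₀ hε]
    nlinarith
  have hlr := log_natCast_le (by omega) hn hε hε1
  have hln := log_natCast_le (by omega : 1 ≤ n) le_rfl hε hε1
  -- Each constant factor 2 is absorbed by n/ε ≥ 2, whence 16 n²/ε ≤ (n/ε)^6. Adding one logarithm
  -- for r and 1 + α for the power of n gives 8 + α ≤ 9 max(1, α).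
  have hlI : Real.log ((numIter r ε : ℝ) + 1) ≤ 6 * Real.log (n / ε) := by
    have e : 6 * Real.log (n / ε) = Real.log ((n / ε) ^ 6) := by
      rw [Real.log_pow]
      norm_num
    rw [e]
    refine Real.log_le_log (by linarith) ((one_add_numIter_le hr hε hε1).trans ?_)
    have h3 := harmonic_cast_le r
    calc 16 * r * (harmonic r : ℝ) / ε ≤ 2 ^ 4 * n * n / ε := by
          have : (0 : ℝ) < harmonic r := harmonic_pos_of_two_le hr
          gcongr
          · norm_num
          · linarith
      _ = 2 ^ 4 * n * (n / ε) := by ring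
      _ ≤ (n / ε) ^ 4 * (n / ε) * (n / ε) := by gcongr
      _ = (n / ε) ^ 6 := by ring
  have hn0 : (0 : ℝ) < n := by linarith
  unfold sampleArg
  rw [Real.log_mul (by positivity) (by positivity), Real.log_mul (by positivity) (by positivity),
    Real.log_rpow (by linarith)]
  have h4 : (1 + α) * Real.log n ≤ (1 + α) * Real.log (n / ε) := by gcongr
  have h5 : (8 + α) * Real.log (n / ε) ≤ 9 * max 1 α * Real.log (n / ε) := by
    gcongr
    linarith [le_max_left 1 α, le_max_right 1 α]
  linarith

theorem numSamples_le (hr : 2 ≤ r) (hn : r ≤ n) (hc : 0 < c) (hc1 : c ≤ 1) (hε : 0 < ε)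
    (hε1 : ε ≤ 1) (hα : 0 < α) :
    (numSamples n r c ε α : ℝ) ≤
      52650 * (Real.log (n / ε) ^ 5 * (r : ℝ) ^ 2 * ε⁻¹ ^ 2 * max 1 α) := by
  have h1 : (2 : ℝ) ≤ r := by exact_mod_cast hr
  obtain ⟨hl, -⟩ := half_le_log_div (hr.trans hn) hε hε1
  have hHn := harmonic_le_log (hr.trans hn) le_rfl hε hε1
  have hHr := harmonic_le_log hr hn hε hε1
  have hHn1 := three_halves_le_harmonic (hr.trans hn)
  have hHr1 := three_halves_le_harmonic hr
  have hlogX := log_sampleArg_le hr hn hε hε1 hα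
  have hκ := density_one_pos hc
  have hκ3 := density_one_le hc hc1
  have hX := two_le_sampleArg (ε := ε) hr hn hα
  have hX0 : 0 ≤ Real.log (sampleArg n r ε α) := Real.log_nonneg (by linarith)
  have hε' : 1 ≤ ε⁻¹ := one_le_inv_iff₀.mpr ⟨hε, hε1⟩
  have hA := le_max_left 1 α
  set l := Real.log (n / ε) with hldef
  set A := max 1 α
  have e1 : density c 1 * ((harmonic n : ℝ) / epsTwo r ε) =
      density c 1 * harmonic n * (4 * r * harmonic r) * ε⁻¹ := by
    unfold epsTwo
    field_simp
  have h2 : (1 / 2 * (density c 1 * ((harmonic n : ℝ) / epsTwo r ε)) ^ 2 *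
      Real.log (sampleArg n r ε α)) ≤
      1 / 2 * (3 * (3 * l) * (4 * r * (3 * l)) * ε⁻¹) ^ 2 * (9 * A * l) := by
    rw [e1]
    gcongr
  have h3 : (numSamples n r c ε α : ℝ) ≤
      1 / 2 * (3 * (3 * l) * (4 * r * (3 * l)) * ε⁻¹) ^ 2 * (9 * A * l) + 1 := by
    rw [numSamples_eq]
    refine (Nat.ceil_lt_add_one (by positivity)).le.trans ?_
    linarith
  -- Absorbs the rounding of the ceiling, using l ≥ 1/2; 52488 + 32 is below the stated constant.
  have h4 : 1 ≤ 32 * l ^ 5 * (r : ℝ) ^ 2 * ε⁻¹ ^ 2 * A := by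
    calc (1 : ℝ) ≤ 32 * (1 / 2) ^ 5 * 1 ^ 2 * 1 ^ 2 * 1 := by norm_num
      _ ≤ 32 * l ^ 5 * (r : ℝ) ^ 2 * ε⁻¹ ^ 2 * A := by
        gcongr
        linarith
  have e2 : 1 / 2 * (3 * (3 * l) * (4 * r * (3 * l)) * ε⁻¹) ^ 2 * (9 * A * l) =
      52488 * (l ^ 5 * (r : ℝ) ^ 2 * ε⁻¹ ^ 2 * A) := by ring
  rw [e2] at h3
  linarith

theorem total_time_le (hr : 2 ≤ r) (hn : r ≤ n) (hc : 0 < c) (hc1 : c ≤ 1) (hε : 0 < ε)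
    (hε1 : ε ≤ 1) (hα : 0 < α) {N : ℕ} (hN : numSamples n r c ε α = N) :
    ((r * (n * (3 * N + 3) + 1) + (3 * N + 1 + numIter r ε * (r * n * (3 * N + 4) + 1)) : ℕ) : ℝ) ≤
      20217600 * Real.log (n / ε) ^ 6 * ((r : ℝ) ^ 4 * n * ε⁻¹ ^ 3 * max 1 α) := by
  have h1 : (2 : ℝ) ≤ r := by exact_mod_cast hr
  have h2 : (2 : ℝ) ≤ n := by exact_mod_cast (hr.trans hn)
  obtain ⟨hl, -⟩ := half_le_log_div (hr.trans hn) hε hε1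
  have hHr := harmonic_le_log hr hn hε hε1
  have hI := one_add_numIter_le hr hε hε1
  have hNle := numSamples_le hr hn hc hc1 hε hε1 hα
  have hN1 : (1 : ℝ) ≤ N := by
    have := numSamples_pos hr hn hc hε hα
    rw [hN] at this
    exact_mod_cast this
  rw [hN] at hNle
  have hA := le_max_left 1 α
  have hI0 := Nat.cast_nonneg (α := ℝ) (numIter r ε)
  set l := Real.log (n / ε) with hldef
  set A := max 1 α
  set I := (numIter r ε : ℝ)
  have hrn : 4 ≤ (r : ℝ) * n := by nlinarith
  have hrnN : (r : ℝ) * n ≤ r * n * N := le_mul_of_one_le_right (by positivity) hN1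
  have hrN : (r : ℝ) ≤ r * n * N := by nlinarith
  have h4N : 4 * (N : ℝ) ≤ r * n * N := by nlinarith
  have h3 : I * (r * n * (3 * N + 4) + 1) ≤ I * (8 * (r * n * N)) := by
    gcongr
    nlinarith
  -- All lower-order terms are absorbed into r n N, using N ≥ 1 and r n ≥ 4. Then 8 · 16 · 3 · 52650
  -- = 20217600.
  have h4 : ((r * (n * (3 * N + 3) + 1) +
      (3 * N + 1 + numIter r ε * (r * n * (3 * N + 4) + 1)) : ℕ) : ℝ) ≤
      8 * (I + 1) * r * n * N := by
    push_cast
    change (r : ℝ) * (n * (3 * N + 3) + 1) + (3 * N + 1 + I * (r * n * (3 * N + 4) + 1)) ≤ _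
    linarith
  have hε' : 0 < ε⁻¹ := inv_pos.mpr hε
  calc _ ≤ 8 * (I + 1) * r * n * N := h4
    _ ≤ 8 * (16 * r * (3 * l) / ε) * r * n *
        (52650 * (l ^ 5 * (r : ℝ) ^ 2 * ε⁻¹ ^ 2 * A)) := by
      gcongr
      refine hI.trans ?_
      gcongr
    _ = 20217600 * l ^ 6 * ((r : ℝ) ^ 4 * n * ε⁻¹ ^ 3 * A) := by
      rw [div_eq_mul_inv]
      ring

end Bounds

/-! ### The main theorem. -/

theorem theorem6p4 :
    ∃ (C : ℝ) (d : ℕ), 0 < C ∧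
      ∀ (U : Type u) [Fintype U] [DecidableEq U] (M : Matroid U) (f : Finset U → ℝ)
        (ord : ScanOrder U) (r : ℕ) (c ε α : ℝ),
        M.E = Set.univ → M.eRank = (r : ℕ∞) → 2 ≤ r →
        IsNormalized f → Monotone f → IsSubmodular f →
        0 < c → c ≤ 1 → HasCurvature f c →
        0 < ε → ε ≤ 1 → 0 < α →
        (∀ z ∈ ((nonObliviousLocalSearch ord r c ε α).run M f).support,
          (z.2 : ℝ) ≤ C * Real.log (Fintype.card U / ε) ^ d *
            ((r : ℝ) ^ 4 * Fintype.card U * ε⁻¹ ^ 3 * max 1 α)) ∧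
        1 - C * (Fintype.card U : ℝ) ^ (-α) ≤
          (((nonObliviousLocalSearch ord r c ε α).run M f).toOuterMeasure
            {z | IsApproxSolution M f (rho c - ε) z.1}).toReal := by
  -- Both values come from `total_time_le`; the failure probability only needs a constant of 4.
  refine ⟨20217600, 6, by norm_num, ?_⟩
  intro U _ _ M f ord r c ε α _ hr hr2 h0 hm hf hc hc1 hcurv hε hε1 hα
  have hn : r ≤ Fintype.card U := by
    obtain ⟨B, hB⟩ := M.exists_isBase
    lift B to Finset U using B.toFinite
    exact (isBase_card hr hB).symm.le.trans (Finset.card_le_univ B)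
  refine ⟨fun z hz => ?_, ?_⟩
  · refine le_trans ?_ (total_time_le hr2 hn hc hc1 hε hε1 hα rfl)
    exact_mod_cast (haltsWithin_nonObliviousLocalSearch ord r c ε α rfl).le_of_mem_support hz
  · set n := Fintype.card U with hndef
    have hX := two_le_sampleArg (ε := ε) hr2 hn hα
    set δ : ℝ := 2 * (sampleArg n r ε α)⁻¹ with hδ
    have hδ0 : 0 ≤ δ := by positivity
    have hest : ∀ A, FailsLE M f (estimate c (numSamples n r c ε α) A)
        (IsAccurate (potential c f) (epsTwo r ε) A) (ENNReal.ofReal δ) := by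
      intro A
      have hτ : tau c A ≤ density c 1 * harmonic n :=
        (tau_le hc A).trans (mul_le_mul_of_nonneg_left
          (harmonic_cast_mono (Finset.card_le_univ A)) (density_one_pos hc).le)
      refine (failsLE_estimate hc h0 hm hf (numSamples_pos hr2 hn hc hε hα)
        (mul_pos (density_one_pos hc) (harmonic_pos_of_two_le (hr2.trans hn)))
        (epsTwo_pos hr2 hε).le hτ).mono (fun _ h => h) (ENNReal.ofReal_le_ofReal ?_)
      exact mul_le_mul_of_nonneg_left (exp_numSamples_le hr2 hn hc hε hα) zero_le_two
    have hfail := failsLE_nonObliviousLocalSearch (α := α) hr hr2 h0 hm hf hc hc1 hcurv hε hε1 ord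
      rfl hest
    have hp : 0 ≤ (n : ℝ) ^ (-α) := Real.rpow_nonneg (Nat.cast_nonneg n) _
    have hle := total_failure_le (ε := ε) (α := α) hr2 hn
    refine le_trans ?_ ((hfail.mono (fun _ h => h) (δ' := ENNReal.ofReal (4 * (n : ℝ) ^ (-α)))
      ?_).one_sub_le (by positivity))
    · linarith
    · rw [← hδ] at hle
      clear_value δ
      refine le_trans (le_of_eq ?_) (ENNReal.ofReal_le_ofReal hle)
      rw [ENNReal.ofReal_add (by positivity) (by positivity),
        ENNReal.ofReal_add (by positivity) (by positivity),
        ENNReal.ofReal_mul (by positivity), ENNReal.ofReal_mul (by positivity),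
        ENNReal.ofReal_mul (by positivity), ENNReal.ofReal_mul (by positivity)]
      simp only [ENNReal.ofReal_natCast, ← hndef]
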